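/- Let $Z=(Z_t)_{t\ge 0}$ be a real-valued Lévy process without Gaussian component, so that $E e^{i\xi Z_t}=e^{-t\psi(\xi)}$ with $$\psi(\xi)=ia\xi+\int_{\mathbb R}\big(1-e^{i\xi u}+i\xi u\,\mathbf 1_{|u|<1}\big)\,\mu(du),\qquad \xi\in\mathbb R,$$ where $a\in\mathbb R$ and $\mu$ is a Lévy measure, i.e. $\mu(\{0\})=0$ and $\int_{\mathbb R}(1\wedge u^2)\,\mu(du)<\infty$. Assume that $\mu(\mathbb R)=\infty$, that $Z$ is symmetric ($-Z_t$ has the same law as $Z_t$ for every $t\ge 0$; equivalently, $\psi$ is real-valued), and that condition A holds: there is $\beta>1$ such that $$\int_{\mathbb R}\big((\xi u)^2\wedge 1\big)\,\mu(du)\le\beta\int_{|\xi u|<1}(\xi u)^2\,\mu(du)\qquad\text{for all }\xi\in\mathbb R.$$ For $t>0$ put $\rho_t=\inf\{\xi>0:\operatorname{Re}\psi(\xi)\ge 1/t\}$ and $\Lambda_t(du)=t\,\mathbf 1_{|\rho_t u|>1}\,\mu(du)$, and let $\Lambda_t^{*m}$ be the $m$-fold convolution power of $\Lambda_t$, with $\Lambda_t^{*0}=\delta_0$.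 Then for every $t>0$ the measure $\Lambda_t$ is finite, $Z_t$ has an infinitely differentiable density $p_t$, and the following hold (all integrals and series below being convergent). 1. For every $t_0>0$ there exist constants $b_1,b_2,b_3,b_4>0$ such that, with $$f_{upper}(x)=b_1e^{-b_2|x|\ln(1+|x|)},\qquad f_{lower}(x)=b_3\mathbf 1_{|x|\le b_4},$$ for all $t\in(0,t_0]$ and $x\in\mathbb R$, $$\sum_{m=0}^\infty\frac1{m!}\int_{\mathbb R}\rho_t\,f_{lower}\big((x-y)\rho_t\big)\,\Lambda_t^{*m}(dy)\;\le\; p_t(x)\;\le\;\sum_{m=0}^\infty\frac1{m!}\int_{\mathbb R}\rho_t\,f_{upper}\big((x-y)\rho_t\big)\,\Lambda_t^{*m}(dy).$$ 2. For every integer $k\ge 1$ and every $t_0>0$ there exist constants $b_1,b_2>0$ such that, with $f_{upper}(x)=b_1e^{-b_2|x|\ln(1+|x|)}$, for all $t\in(0,t_0]$ and $x\in\mathbb R$, $$\left|\frac{\partial^k}{\partial x^k}p_t(x)\right|\le\sum_{m=0}^\infty\frac1{m!}\int_{\mathbb R}\rho_t^{k+1}\,f_{upper}\big((x-y)\rho_t\big)\,\Lambda_t^{*m}(dy).$$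 -/

import Mathlib

open MeasureTheory ProbabilityTheory Filter Topology
open scoped NNReal ENNReal

noncomputable section

namespace LevyKernel

/-- A real-valued Lévy process on the probability space `(Ω, P)`: it starts at `0`, has independent
and stationary increments, and is stochastically continuous. -/
structure IsLevyProcess {Ω : Type*} [MeasurableSpace Ω] (Z : ℝ≥0 → Ω → ℝ) (P : Measure Ω) :
    Prop where
  measurable : ∀ t, Measurable (Z t)
  zero : ∀ᵐ ω ∂P, Z 0 ω = 0
  indep : HasIndepIncrements Z P
  stationary : ∀ s t : ℝ≥0, P.map (fun ω => Z (s + t) ω - Z s ω) = P.map (Z t)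
  stochCont : ∀ s : ℝ≥0, TendstoInMeasure P Z (𝓝 s) (Z s)

/-- The process is symmetric: `Z t` and `-Z t` have the same law for every `t`. -/
def IsSymmetricProcess {Ω : Type*} [MeasurableSpace Ω] (Z : ℝ≥0 → Ω → ℝ) (P : Measure Ω) : Prop :=
  ∀ t : ℝ≥0, P.map (fun ω => -Z t ω) = P.map (Z t)

/-- A Lévy measure on `ℝ`: no mass at `0` and `∫ (1 ∧ u²) μ(du) < ∞`. -/
def IsLevyMeasure (μ : Measure ℝ) : Prop :=
  μ {0} = 0 ∧ ∫⁻ u, ENNReal.ofReal (min 1 (u ^ 2)) ∂μ < ∞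

/-- The exponent `ψ(ξ) = i a ξ + ∫ (1 - e^{iξu} + iξu 1_{|u| < 1}) μ(du)`
(no Gaussian component). -/
def charExponent (a : ℝ) (μ : Measure ℝ) (ξ : ℝ) : ℂ :=
  Complex.I * a * ξ +
    ∫ u : ℝ, (1 - Complex.exp (Complex.I * ξ * u) +
      (if |u| < 1 then Complex.I * ξ * u else 0)) ∂μ

/-- `Z` has characteristic exponent `ψ`: `E exp(iξ Z_t) = exp(-t ψ(ξ))`. -/
def HasCharExponent {Ω : Type*} [MeasurableSpace Ω] (Z : ℝ≥0 → Ω → ℝ) (P : Measure Ω)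
    (ψ : ℝ → ℂ) : Prop :=
  ∀ (t : ℝ≥0) (ξ : ℝ), charFun (P.map (Z t)) ξ = Complex.exp (-((t : ℝ) : ℂ) * ψ ξ)

/-- `ψ^L(ξ) = ∫_{|ξu| < 1} (ξu)² μ(du)`. -/
def psiL (μ : Measure ℝ) (ξ : ℝ) : ℝ :=
  ∫ u : ℝ, (if |ξ * u| < 1 then (ξ * u) ^ 2 else 0) ∂μ

/-- `ψ^U(ξ) = ∫ ((ξu)² ∧ 1) μ(du)`. -/
def psiU (μ : Measure ℝ) (ξ : ℝ) : ℝ :=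
  ∫ u : ℝ, min ((ξ * u) ^ 2) 1 ∂μ

/-- Condition **A**: `ψ^U ≤ β ψ^L` on `ℝ` for some `β > 1`. -/
def ConditionA (μ : Measure ℝ) : Prop :=
  ∃ β : ℝ, 1 < β ∧ ∀ ξ : ℝ, psiU μ ξ ≤ β * psiL μ ξ

/-- `ρ_t = inf {ξ > 0 : Re ψ(ξ) ≥ 1/t}`, for `t > 0`. -/
def rho (ψ : ℝ → ℂ) (t : ℝ) : ℝ :=
  sInf {ξ : ℝ | 0 < ξ ∧ 1 / t ≤ (ψ ξ).re}

/-- `Λ_t(du) = t 1_{|ρ_t u| > 1} μ(du)`. -/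
def Lam (ψ : ℝ → ℂ) (μ : Measure ℝ) (t : ℝ) : Measure ℝ :=
  ENNReal.ofReal t • μ.restrict {u : ℝ | 1 < |rho ψ t * u|}

/-- The `m`-fold convolution power `Q^{*m}`, with `Q^{*0} = δ_0`. -/
def convPow (Q : Measure ℝ) : ℕ → Measure ℝ
  | 0 => Measure.dirac 0
  | m + 1 => Measure.conv Q (convPow Q m)

/-- The term `(1/m!) ∫ σ_t h((x - y) ζ_t) Q_t^{*m}(dy)` of the compound kernel. -/
def compoundTerm (σ : ℝ → ℝ) (h : ℝ → ℝ) (ζ : ℝ → ℝ) (Q : ℝ → Measure ℝ) (t x : ℝ) (m : ℕ) : ℝ :=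
  (1 / (m.factorial : ℝ)) * ∫ y : ℝ, σ t * h ((x - y) * ζ t) ∂(convPow (Q t) m)

/-- The compound kernel with parameters `(σ, h, ζ, Q)` is meaningful at `(t, x)`: the measure `Q_t`
is finite, all the integrals converge, and so does the series. -/
structure CompoundKernelConverges (σ : ℝ → ℝ) (h : ℝ → ℝ) (ζ : ℝ → ℝ) (Q : ℝ → Measure ℝ)
    (t x : ℝ) : Prop where
  finite : IsFiniteMeasure (Q t)
  integrable : ∀ m : ℕ, Integrable (fun y : ℝ => σ t * h ((x - y) * ζ t)) (convPow (Q t) m)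
  summable : Summable (compoundTerm σ h ζ Q t x)

/-- `g` satisfies on `A` the upper compound kernel estimate with parameters `(σ, h, ζ, Q)`. -/
def UpperCompoundKernelEstimate (g : ℝ → ℝ → ℝ) (A : Set (ℝ × ℝ)) (σ : ℝ → ℝ) (h : ℝ → ℝ)
    (ζ : ℝ → ℝ) (Q : ℝ → Measure ℝ) : Prop :=
  ∀ t x : ℝ, (t, x) ∈ A →
    CompoundKernelConverges σ h ζ Q t x ∧ g t x ≤ ∑' m : ℕ, compoundTerm σ h ζ Q t x m

/-- `g` satisfies on `A` the lower compound kernel estimate with parameters `(σ, h, ζ, Q)`. -/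
def LowerCompoundKernelEstimate (g : ℝ → ℝ → ℝ) (A : Set (ℝ × ℝ)) (σ : ℝ → ℝ) (h : ℝ → ℝ)
    (ζ : ℝ → ℝ) (Q : ℝ → Measure ℝ) : Prop :=
  ∀ t x : ℝ, (t, x) ∈ A →
    CompoundKernelConverges σ h ζ Q t x ∧ ∑' m : ℕ, compoundTerm σ h ζ Q t x m ≤ g t x

/-- `f_upper(x) = b₁ exp(-b₂ |x| ln(1 + |x|))`. -/
def fUpperSym (b₁ b₂ : ℝ) (x : ℝ) : ℝ :=
  b₁ * Real.exp (-b₂ * |x| * Real.log (1 + |x|))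

/-- `f_lower(x) = b₃ 1_{|x| ≤ b₄}`. -/
def fLower (b₃ b₄ : ℝ) (x : ℝ) : ℝ :=
  b₃ * (if |x| ≤ b₄ then 1 else 0)

/-- `p t` is, for every `t > 0`, the nonnegative infinitely differentiable density of `Z t`.
(A continuous density is unique, so this determines `p t` everywhere.) -/
def IsSmoothTransitionDensity {Ω : Type*} [MeasurableSpace Ω] (Z : ℝ≥0 → Ω → ℝ) (P : Measure Ω)
    (p : ℝ → ℝ → ℝ) : Prop :=
  ∀ t : ℝ≥0, 0 < t →
    ContDiff ℝ (⊤ : ℕ∞) (p t) ∧ (∀ x : ℝ, 0 ≤ p t x) ∧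
      P.map (Z t) = volume.withDensity (fun x : ℝ => ENNReal.ofReal (p t x))

end LevyKernel

end

namespace LevyKernel

/-! ### Exponential of a finite measure with respect to convolution -/

/-! Split the jumps at size `1 / ρ_t`. The jumps above this threshold have intensity `Λ_t`, a finite
measure, and form a compound Poisson law `e^{-Λ_t(ℝ)} ∑ Λ_t^{*m} / m!`. The jumps below it,
multiplied by `ρ_t`, live on `[-1, 1]` and have a smooth density `G`. Hence `p_t(x) = e^{-Λ_t(ℝ)}
ρ_t ∫ G((x - y) ρ_t) E(dy)` with `E` the convolution exponential of `Λ_t` (`transitionDensity`,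
identified through characteristic functions in `charFun_transitionDensity`). The compound kernels of
the theorem are integrals against the same `E` (`hasSum_compoundTerm`), so everything reduces to
bounds on `G` and on `Λ_t(ℝ)` that are uniform in `t`.

Uniformity comes from condition A. By `rho_pos_and_cosExp_rho`, `t Re ψ(ρ_t) = 1`. Condition A makes
`Re ψ` comparable with `ψ^U`, so `t ψ^U(ρ_t)` lies between `1/2` and `3β`; this bounds both `Λ_t(ℝ)`
and the second moment of the rescaled small jumps. Condition A also forces `ψ^U` to grow
geometrically under doubling (`psiU_two_pow`), so the Fourier transform of `G` decays faster than
every power. These facts are collected in `isSmallJump_map`, with constants that depend only on `β`.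

The upper bound for `G` and its derivatives is a contour shift: since the jumps are bounded, the
exponent is entire, and moving the Fourier integral to a height of order `log(1 + |x|)` gives the
factor `e^{-|x| log(1 + |x|) / 8}` (`norm_integral_jumpIntegrand_le_fUpperSym`). The lower bound is
local: `G(0)` is bounded below by comparison with a Gaussian and `G'` is bounded
(`IsSmallJump.fLower_le`). Away from `0` only `G ≥ 0` is needed, and it is obtained by Gaussian
smoothing and truncation (`IsSmallJump.fourier_nonneg`).

Symmetry makes `ψ` real, and `integral_eq_zero_of_odd` transfers this to the Lévy measure, so that
each of the two parts has a real exponent. -/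

instance isFiniteMeasure_convPow (Q : Measure ℝ) [IsFiniteMeasure Q] (m : ℕ) :
    IsFiniteMeasure (convPow Q m) := by
  induction m with
  | zero => rw [convPow]; infer_instance
  | succ m ih => rw [convPow]; infer_instance

theorem convPow_univ (Q : Measure ℝ) [IsFiniteMeasure Q] (m : ℕ) :
    convPow Q m Set.univ = Q Set.univ ^ m := by
  induction m with
  | zero => simp [convPow]
  | succ m ih =>
    rw [convPow, Measure.conv, Measure.map_apply (by fun_prop) MeasurableSet.univ, Set.preimage_univ,
      Measure.prod_apply MeasurableSet.univ]
    simp [ih, pow_succ]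

theorem charFun_convPow (Q : Measure ℝ) [IsFiniteMeasure Q] (m : ℕ) (ξ : ℝ) :
    charFun (convPow Q m) ξ = charFun Q ξ ^ m := by
  induction m with
  | zero => simp [convPow]
  | succ m ih => rw [convPow, charFun_conv, ih, pow_succ']

/-- The convolution exponential `∑ Q^{*m} / m!`. -/
noncomputable def convExp (Q : Measure ℝ) : Measure ℝ :=
  Measure.sum fun m : ℕ => ENNReal.ofReal (1 / (m.factorial : ℝ)) • convPow Q m

theorem convExp_univ (Q : Measure ℝ) [IsFiniteMeasure Q] :
    convExp Q Set.univ = ENNReal.ofReal (Real.exp (Q.real Set.univ)) := by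
  have hs : HasSum (fun m : ℕ => Q.real Set.univ ^ m / (m.factorial : ℝ))
      (Real.exp (Q.real Set.univ)) := by
    rw [Real.exp_eq_exp_ℝ]; exact NormedSpace.expSeries_div_hasSum_exp _
  have hpos : ∀ m : ℕ, 0 ≤ Q.real Set.univ ^ m / (m.factorial : ℝ) := fun m => by positivity
  rw [convExp, Measure.sum_apply _ MeasurableSet.univ, ← hs.tsum_eq,
    ENNReal.ofReal_tsum_of_nonneg hpos hs.summable]
  congr 1
  ext m
  rw [Measure.smul_apply, convPow_univ, smul_eq_mul, div_eq_mul_one_div (Q.real _ ^ m),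
    mul_comm (Q.real _ ^ m), ENNReal.ofReal_mul (by positivity),
    ENNReal.ofReal_pow (by positivity), ofReal_measureReal]

instance isFiniteMeasure_convExp (Q : Measure ℝ) [IsFiniteMeasure Q] :
    IsFiniteMeasure (convExp Q) :=
  ⟨by rw [convExp_univ]; exact ENNReal.ofReal_lt_top⟩

theorem hasSum_integral_convExp {E : Type*} [NormedAddCommGroup E] [NormedSpace ℝ E]
    (Q : Measure ℝ) {f : ℝ → E} (hf : Integrable f (convExp Q)) :
    HasSum (fun m : ℕ => (1 / (m.factorial : ℝ)) • ∫ y, f y ∂(convPow Q m))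
      (∫ y, f y ∂(convExp Q)) := by
  refine (hasSum_integral_measure hf).congr_fun fun m => ?_
  rw [integral_smul_measure, ENNReal.toReal_ofReal (by positivity)]

theorem charFun_convExp (Q : Measure ℝ) [IsFiniteMeasure Q] (ξ : ℝ) :
    charFun (convExp Q) ξ = Complex.exp (charFun Q ξ) := by
  have hi : Integrable (fun x : ℝ => Complex.exp (ξ * x * Complex.I)) (convExp Q) := by
    refine Integrable.of_bound (by fun_prop) 1 (ae_of_all _ fun x => ?_)
    rw [← Complex.ofReal_mul, Complex.norm_exp_ofReal_mul_I]
  have h := hasSum_integral_convExp Q hi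
  rw [charFun_apply_real]
  refine h.unique ?_
  have h2 : HasSum (fun m : ℕ => charFun Q ξ ^ m / (m.factorial : ℂ))
      (Complex.exp (charFun Q ξ)) := by
    rw [Complex.exp_eq_exp_ℂ]; exact NormedSpace.expSeries_div_hasSum_exp _
  refine h2.congr_fun fun m => ?_
  rw [← charFun_apply_real, charFun_convPow, Complex.real_smul]
  push_cast
  ring

/-! ### Shifting the contour of integration -/

/-- Cauchy's theorem on the rectangle with base `[-T, T]`: the assumed decay, uniform over the
strip, makes the vertical sides `O(1 / (1 + T²))`, and `T → ∞`. -/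
theorem integral_shift_eq {h : ℂ → ℂ} (hd : Differentiable ℂ h) {R C : ℝ}
    (hb : ∀ x : ℝ, ∀ y ∈ Set.uIcc 0 R, ‖h (x + y * Complex.I)‖ ≤ C * (1 + x ^ 2)⁻¹) :
    ∫ x : ℝ, h x = ∫ x : ℝ, h (x + R * Complex.I) := by
  have hi : ∀ y ∈ Set.uIcc 0 R, Integrable (fun x : ℝ => h (x + y * Complex.I)) := fun y hy =>
    (integrable_inv_one_add_sq.const_mul C).mono' (by
      exact (hd.continuous.comp (by fun_prop)).aestronglyMeasurable) (ae_of_all _ fun x => hb x y hy)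
  have h0 : Integrable (fun x : ℝ => h x) := by simpa using hi 0 Set.left_mem_uIcc
  have hR := hi R Set.right_mem_uIcc
  have t0 := intervalIntegral_tendsto_integral h0 tendsto_neg_atTop_atBot tendsto_id
  have tR := intervalIntegral_tendsto_integral hR tendsto_neg_atTop_atBot tendsto_id
  have key : ∀ T : ℝ, (∫ x in (-T)..T, h x) - (∫ x in (-T)..T, h (x + R * Complex.I)) =
      Complex.I • (∫ y in (0 : ℝ)..R, h ((-T : ℝ) + y * Complex.I)) -
        Complex.I • ∫ y in (0 : ℝ)..R, h (T + y * Complex.I) := by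
    intro T
    have := Complex.integral_boundary_rect_eq_zero_of_differentiableOn h (⟨-T, 0⟩ : ℂ) ⟨T, R⟩
      hd.differentiableOn
    simp only [Complex.ofReal_zero, zero_mul, add_zero] at this
    linear_combination this
  have hv : ∀ T : ℝ, ‖(∫ x in (-T)..T, h x) - (∫ x in (-T)..T, h (x + R * Complex.I))‖ ≤
      2 * |R| * C * (1 + T ^ 2)⁻¹ := by
    intro T
    rw [key]
    have b : ∀ T : ℝ, ‖∫ y in (0 : ℝ)..R, h (T + y * Complex.I)‖ ≤
        C * (1 + T ^ 2)⁻¹ * |R - 0| := fun T =>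
      intervalIntegral.norm_integral_le_of_norm_le_const fun y hy =>
        hb T y (Set.uIoc_subset_uIcc hy)
    refine (norm_sub_le _ _).trans ?_
    rw [norm_smul, norm_smul, Complex.norm_I, one_mul, one_mul]
    have b1 := b (-T)
    have b2 := b T
    rw [neg_sq, sub_zero] at b1
    rw [sub_zero] at b2
    linarith
  have hz : Tendsto (fun T : ℝ => 2 * |R| * C * (1 + T ^ 2)⁻¹) atTop (𝓝 0) := by
    rw [← mul_zero (2 * |R| * C)]
    refine Tendsto.const_mul _ (tendsto_inv_atTop_zero.comp ?_)
    exact tendsto_atTop_add_const_left _ _ (tendsto_pow_atTop two_ne_zero)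
  have := tendsto_nhds_unique (t0.sub tR) (squeeze_zero_norm hv hz)
  exact sub_eq_zero.1 this

/-! ### Elementary bounds -/

/-- Minus the average of the second-order Taylor remainders of `exp` at `iz` and `-iz`, whose linear
terms cancel. -/
theorem norm_one_sub_cos_le (z : ℂ) : ‖1 - Complex.cos z‖ ≤ ‖z‖ ^ 2 * Real.exp ‖z‖ := by
  have h : ∀ w : ℂ, ‖Complex.exp w - (1 + w)‖ ≤ ‖w‖ ^ 2 * Real.exp ‖w‖ := fun w => by
    simpa [Finset.sum_range_succ] using Complex.norm_exp_sub_sum_le_norm_mul_exp w 2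
  have h1 := h (z * Complex.I)
  have h2 := h (-z * Complex.I)
  simp only [norm_mul, norm_neg, Complex.norm_I, mul_one] at h1 h2
  have : 1 - Complex.cos z = -((Complex.exp (z * Complex.I) - (1 + z * Complex.I)) +
      (Complex.exp (-z * Complex.I) - (1 + -z * Complex.I))) / 2 := by
    rw [Complex.cos]; ring
  rw [this, norm_div, norm_neg]
  have := norm_add_le (Complex.exp (z * Complex.I) - (1 + z * Complex.I))
    (Complex.exp (-z * Complex.I) - (1 + -z * Complex.I))
  simp only [Complex.norm_ofNat]
  linarith

theorem norm_sin_le (z : ℂ) : ‖Complex.sin z‖ ≤ ‖z‖ * Real.exp ‖z‖ := by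
  have h : ∀ w : ℂ, ‖Complex.exp w - 1‖ ≤ ‖w‖ * Real.exp ‖w‖ := fun w => by
    simpa [Finset.sum_range_succ] using Complex.norm_exp_sub_sum_le_norm_mul_exp w 1
  have h1 := h (z * Complex.I)
  have h2 := h (-z * Complex.I)
  simp only [norm_mul, norm_neg, Complex.norm_I, mul_one] at h1 h2
  have : Complex.sin z = ((Complex.exp (-z * Complex.I) - 1) -
      (Complex.exp (z * Complex.I) - 1)) * Complex.I / 2 := by
    rw [Complex.sin]; ring
  rw [this, norm_div, norm_mul, Complex.norm_I]
  have := norm_sub_le (Complex.exp (-z * Complex.I) - 1) (Complex.exp (z * Complex.I) - 1)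
  simp only [Complex.norm_ofNat]
  linarith

theorem cosh_sub_one_le (y : ℝ) : Real.cosh y - 1 ≤ y ^ 2 * Real.exp |y| := by
  have h := norm_one_sub_cos_le (y * Complex.I)
  rw [Complex.cos_mul_I, ← Complex.ofReal_cosh, norm_mul, Complex.norm_I, mul_one,
    Complex.norm_real, Real.norm_eq_abs, sq_abs, ← Complex.ofReal_one, ← Complex.ofReal_sub,
    Complex.norm_real, Real.norm_eq_abs, abs_sub_comm] at h
  exact (le_abs_self _).trans h

theorem one_sub_cos_le (x : ℝ) : 1 - Real.cos x ≤ x ^ 2 / 2 := by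
  linarith [Real.one_sub_sq_div_two_le_cos (x := x)]

theorem one_sub_cos_nonneg (x : ℝ) : 0 ≤ 1 - Real.cos x := by linarith [Real.cos_le_one x]

/-! ### Cosine exponents and their entire extensions -/

/-- The real exponent `∫ (1 - cos (ηv)) ν(dv)`. -/
noncomputable def cosExp (ν : Measure ℝ) (η : ℝ) : ℝ := ∫ v : ℝ, (1 - Real.cos (η * v)) ∂ν

/-- The extension of `cosExp` to complex arguments. -/
noncomputable def cosExpC (ν : Measure ℝ) (z : ℂ) : ℂ := ∫ v : ℝ, (1 - Complex.cos (z * v)) ∂ν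

theorem cosExpC_ofReal (ν : Measure ℝ) (η : ℝ) : cosExpC ν η = cosExp ν η := by
  rw [cosExpC, cosExp, ← integral_complex_ofReal]
  congr 1 with v
  push_cast
  rfl

theorem cosExp_nonneg (ν : Measure ℝ) (η : ℝ) : 0 ≤ cosExp ν η :=
  integral_nonneg fun _ => one_sub_cos_nonneg _

theorem integrable_one_sub_cos {ν : Measure ℝ} (hν : Integrable (fun v : ℝ => v ^ 2) ν) (η : ℝ) :
    Integrable (fun v : ℝ => 1 - Real.cos (η * v)) ν := by
  refine (hν.const_mul (η ^ 2 / 2)).mono' (by fun_prop) (ae_of_all _ fun v => ?_)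
  rw [Real.norm_of_nonneg (one_sub_cos_nonneg _)]
  have := one_sub_cos_le (η * v)
  nlinarith

theorem cosExp_le {ν : Measure ℝ} (hν : Integrable (fun v : ℝ => v ^ 2) ν) (η : ℝ) :
    cosExp ν η ≤ η ^ 2 / 2 * ∫ v : ℝ, v ^ 2 ∂ν := by
  rw [← integral_const_mul]
  refine integral_mono (integrable_one_sub_cos hν η) (hν.const_mul _) fun v => ?_
  have := one_sub_cos_le (η * v)
  simp only
  nlinarith

variable {ν : Measure ℝ}

theorem integrable_one_sub_ccos (hs : ∀ᵐ v ∂ν, |v| ≤ 1)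
    (hν : Integrable (fun v : ℝ => v ^ 2) ν) (z : ℂ) :
    Integrable (fun v : ℝ => 1 - Complex.cos (z * v)) ν := by
  refine (hν.const_mul (‖z‖ ^ 2 * Real.exp ‖z‖)).mono' (by fun_prop) ?_
  filter_upwards [hs] with v hv
  refine (norm_one_sub_cos_le _).trans ?_
  rw [norm_mul, Complex.norm_real, Real.norm_eq_abs, mul_pow, sq_abs]
  have : Real.exp (‖z‖ * |v|) ≤ Real.exp ‖z‖ :=
    Real.exp_le_exp.2 (mul_le_of_le_one_right (norm_nonneg _) hv)
  calc ‖z‖ ^ 2 * v ^ 2 * Real.exp (‖z‖ * |v|) ≤ ‖z‖ ^ 2 * v ^ 2 * Real.exp ‖z‖ := by gcongr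
    _ = _ := by ring

/-- Bounded jumps keep the exponential growth of `sin (z v)` under control locally uniformly in `z`,
so one may differentiate under the integral; the second moment pays for the singularity at `0`. -/
theorem differentiable_cosExpC (hs : ∀ᵐ v ∂ν, |v| ≤ 1)
    (hν : Integrable (fun v : ℝ => v ^ 2) ν) : Differentiable ℂ (cosExpC ν) := by
  intro z
  have h := hasDerivAt_integral_of_dominated_loc_of_deriv_le (μ := ν) (𝕜 := ℂ)
    (F := fun z (v : ℝ) => 1 - Complex.cos (z * v)) (F' := fun z (v : ℝ) => v * Complex.sin (z * v))
    (bound := fun v => ((‖z‖ + 1) * Real.exp (‖z‖ + 1)) * v ^ 2) (x₀ := z)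
    (Metric.ball_mem_nhds z one_pos) (.of_forall fun _ => by fun_prop)
    (integrable_one_sub_ccos hs hν z) (by fun_prop) ?_ (hν.const_mul _) ?_
  · exact h.2.differentiableAt
  · filter_upwards [hs] with v hv w hw
    have hw' : ‖w‖ ≤ ‖z‖ + 1 := by
      have := norm_le_norm_add_norm_sub' w z
      rw [← dist_eq_norm] at this
      linarith [Metric.mem_ball.1 hw]
    have h1 := norm_sin_le (w * v)
    rw [norm_mul, Complex.norm_real, Real.norm_eq_abs] at h1
    rw [norm_mul, Complex.norm_real, Real.norm_eq_abs]
    have h2 : ‖w‖ * |v| ≤ ‖z‖ + 1 := by nlinarith [norm_nonneg w, abs_nonneg v]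
    calc |v| * ‖Complex.sin (w * v)‖ ≤ |v| * (‖w‖ * |v| * Real.exp (‖w‖ * |v|)) := by gcongr
      _ ≤ |v| * ((‖z‖ + 1) * |v| * Real.exp (‖z‖ + 1)) := by gcongr
      _ = (‖z‖ + 1) * Real.exp (‖z‖ + 1) * |v| ^ 2 := by ring
      _ = _ := by rw [sq_abs]
  · refine ae_of_all _ fun v w _ => ?_
    have := ((Complex.hasDerivAt_cos (w * v)).comp w
      ((hasDerivAt_id w).mul_const (v : ℂ))).const_sub 1
    refine this.congr_deriv ?_
    simp only [one_mul]
    ring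

/-- Leaving the real axis costs an additive error independent of `η`: the integrand has real part
`(1 - cos ηv) - cos ηv (cosh wv - 1)`, and `cosh wv - 1` is at most `2 e^{2|w|} v²`. Hence the decay
in `η` survives on every horizontal line. -/
theorem re_cosExpC_ge (hs : ∀ᵐ v ∂ν, |v| ≤ 1) (hν : Integrable (fun v : ℝ => v ^ 2) ν)
    (η w : ℝ) :
    cosExp ν η - 2 * (∫ v : ℝ, v ^ 2 ∂ν) * Real.exp (2 * |w|) ≤
      (cosExpC ν (η + w * Complex.I)).re := by
  have hre : (cosExpC ν (η + w * Complex.I)).re =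
      ∫ v : ℝ, (1 - Complex.cos ((η + w * Complex.I) * v)).re ∂ν :=
    (integral_re (𝕜 := ℂ) (integrable_one_sub_ccos hs hν _)).symm
  rw [hre, cosExp, mul_right_comm, ← integral_const_mul,
    ← integral_sub (integrable_one_sub_cos hν η) (hν.const_mul _)]
  refine integral_mono_ae ((integrable_one_sub_cos hν η).sub (hν.const_mul _))
    (integrable_one_sub_ccos hs hν _).re ?_
  filter_upwards [hs] with v hv
  have e : ((η : ℂ) + w * Complex.I) * v = ((η * v : ℝ) : ℂ) + ((w * v : ℝ) : ℂ) * Complex.I := by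
    push_cast; ring
  have hcos : (1 - Complex.cos (((η : ℂ) + w * Complex.I) * v)).re =
      1 - Real.cos (η * v) * Real.cosh (w * v) := by
    rw [e, Complex.cos_add_mul_I, ← Complex.ofReal_cos, ← Complex.ofReal_cosh,
      ← Complex.ofReal_sin, ← Complex.ofReal_sinh]
    simp only [Complex.sub_re, Complex.one_re, Complex.mul_re, Complex.mul_im, Complex.ofReal_re,
      Complex.ofReal_im, Complex.I_re, Complex.I_im]
    ring
  simp only [hcos]
  have h1 := cosh_sub_one_le (w * v)
  have h2 : |w * v| ≤ |w| := by
    rw [abs_mul]; exact mul_le_of_le_one_right (abs_nonneg _) hv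
  have h3 : (w * v) ^ 2 * Real.exp |w * v| ≤ 2 * Real.exp (2 * |w|) * v ^ 2 := by
    have h4 : w ^ 2 ≤ 2 * Real.exp |w| := by
      have := Real.quadratic_le_exp_of_nonneg (abs_nonneg w)
      rw [sq_abs] at this
      nlinarith [abs_nonneg w]
    calc (w * v) ^ 2 * Real.exp |w * v| ≤ (w * v) ^ 2 * Real.exp |w| := by gcongr
      _ = w ^ 2 * Real.exp |w| * v ^ 2 := by ring
      _ ≤ 2 * Real.exp |w| * Real.exp |w| * v ^ 2 := by gcongr
      _ = 2 * Real.exp (2 * |w|) * v ^ 2 := by rw [two_mul |w|, Real.exp_add]; ring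
  have h5 : Real.cos (η * v) * (Real.cosh (w * v) - 1) ≤ Real.cosh (w * v) - 1 :=
    mul_le_of_le_one_left (by linarith [Real.one_le_cosh (w * v)]) (Real.cos_le_one _)
  nlinarith

/-! ### Decay of the density of small jumps -/

/-- `ν` lives on `[-1, 1]`, has second moment at most `K`, and `exp (-cosExp ν)` decreases faster
than any power, at rates prescribed by `D`. -/
structure IsSmallJump (ν : Measure ℝ) (K : ℝ) (D : ℕ → ℝ) : Prop where
  supp : ∀ᵐ v ∂ν, |v| ≤ 1
  integrable_sq : Integrable (fun v : ℝ => v ^ 2) ν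
  integral_sq_le : ∫ v : ℝ, v ^ 2 ∂ν ≤ K
  decay : ∀ (k : ℕ) (η : ℝ), (1 + |η|) ^ k * Real.exp (-cosExp ν η) ≤ D k

/-- The holomorphic integrand of the `k`-th derivative of the density at `x`. -/
noncomputable def jumpIntegrand (ν : Measure ℝ) (k : ℕ) (x : ℝ) (z : ℂ) : ℂ :=
  Complex.exp (-2 * Real.pi * Complex.I * x * z) * (-2 * Real.pi * Complex.I * z) ^ k *
    Complex.exp (-cosExpC ν (2 * Real.pi * z))

variable {K : ℝ} {D : ℕ → ℝ}

theorem IsSmallJump.one_le (h : IsSmallJump ν K D) (k : ℕ) : 1 ≤ D k := by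
  simpa [cosExp] using h.decay k 0

theorem IsSmallJump.nonneg (h : IsSmallJump ν K D) : 0 ≤ K :=
  (integral_nonneg fun v => sq_nonneg v).trans h.integral_sq_le

/-- Two of the available powers are traded for an integrable factor. -/
theorem IsSmallJump.decay_inv (h : IsSmallJump ν K D) (k : ℕ) (η : ℝ) :
    (1 + |2 * Real.pi * η|) ^ k * Real.exp (-cosExp ν (2 * Real.pi * η)) ≤
      D (k + 2) * (1 + η ^ 2)⁻¹ := by
  rw [← div_eq_mul_inv, le_div_iff₀ (by positivity)]
  refine le_trans ?_ (h.decay (k + 2) (2 * Real.pi * η))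
  rw [pow_add, mul_right_comm]
  have : 1 + η ^ 2 ≤ (1 + |2 * Real.pi * η|) ^ 2 := by
    have h1 : |η| ≤ |2 * Real.pi * η| := by
      rw [abs_mul, abs_of_pos Real.two_pi_pos]
      nlinarith [Real.pi_gt_three, abs_nonneg η]
    nlinarith [sq_abs η, abs_nonneg η]
  gcongr

theorem differentiable_jumpIntegrand (h : IsSmallJump ν K D) (k : ℕ) (x : ℝ) :
    Differentiable ℂ (jumpIntegrand ν k x) := by
  have := differentiable_cosExpC h.supp h.integrable_sq
  unfold jumpIntegrand
  fun_prop

theorem norm_jumpIntegrand_le (h : IsSmallJump ν K D) (k : ℕ) (x η y : ℝ) :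
    ‖jumpIntegrand ν k x (η + y * Complex.I)‖ ≤
      Real.exp (2 * Real.pi * y * x + 2 * K * Real.exp (4 * Real.pi * |y|)) *
        (1 + 2 * Real.pi * |y|) ^ k * D (k + 2) * (1 + η ^ 2)⁻¹ := by
  have hpi := Real.pi_pos
  rw [jumpIntegrand, norm_mul, norm_mul, norm_pow, Complex.norm_exp, Complex.norm_exp]
  have e1 : (-2 * Real.pi * Complex.I * x * (η + y * Complex.I)).re = 2 * Real.pi * y * x := by
    simp; ring
  have e2 : (2 * Real.pi * (η + y * Complex.I) : ℂ) =
      ((2 * Real.pi * η : ℝ) : ℂ) + ((2 * Real.pi * y : ℝ) : ℂ) * Complex.I := by push_cast; ring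
  have e3 : ‖-2 * Real.pi * Complex.I * (η + y * Complex.I)‖ ≤
      (1 + |2 * Real.pi * η|) * (1 + 2 * Real.pi * |y|) := by
    have : -2 * Real.pi * Complex.I * (η + y * Complex.I) =
      -Complex.I * (2 * Real.pi * (η + y * Complex.I)) := by ring
    rw [this, e2, norm_mul, norm_neg, Complex.norm_I, one_mul]
    refine (norm_add_le _ _).trans ?_
    rw [norm_mul, Complex.norm_I, Complex.norm_real, Complex.norm_real, Real.norm_eq_abs,
      Real.norm_eq_abs, abs_mul _ y, abs_of_pos Real.two_pi_pos]
    nlinarith [mul_nonneg (abs_nonneg (2 * Real.pi * η))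
      (mul_nonneg Real.two_pi_pos.le (abs_nonneg y))]
  have e4 := re_cosExpC_ge h.supp h.integrable_sq (2 * Real.pi * η) (2 * Real.pi * y)
  rw [← e2, abs_mul, abs_of_pos Real.two_pi_pos,
    show 2 * (2 * Real.pi * |y|) = 4 * Real.pi * |y| by ring] at e4
  have e5 : 2 * (∫ v : ℝ, v ^ 2 ∂ν) * Real.exp (4 * Real.pi * |y|) ≤
      2 * K * Real.exp (4 * Real.pi * |y|) := by
    have := h.integral_sq_le
    gcongr
  rw [e1, Complex.neg_re]
  calc _ ≤ Real.exp (2 * Real.pi * y * x) *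
        ((1 + |2 * Real.pi * η|) * (1 + 2 * Real.pi * |y|)) ^ k *
        Real.exp (2 * K * Real.exp (4 * Real.pi * |y|) - cosExp ν (2 * Real.pi * η)) := by
        gcongr
        linarith
    _ = Real.exp (2 * Real.pi * y * x + 2 * K * Real.exp (4 * Real.pi * |y|)) *
        (1 + 2 * Real.pi * |y|) ^ k *
        ((1 + |2 * Real.pi * η|) ^ k * Real.exp (-cosExp ν (2 * Real.pi * η))) := by
        rw [Real.exp_add, sub_eq_add_neg, Real.exp_add, mul_pow]; ring
    _ ≤ _ := by
        rw [mul_assoc _ (D (k + 2))]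
        refine mul_le_mul_of_nonneg_left ?_ (by positivity)
        exact h.decay_inv k η

theorem norm_integral_jumpIntegrand_le (h : IsSmallJump ν K D) (k : ℕ) (x R : ℝ) :
    ‖∫ η : ℝ, jumpIntegrand ν k x η‖ ≤
      Real.exp (2 * Real.pi * R * x + 2 * K * Real.exp (4 * Real.pi * |R|)) *
        (1 + 2 * Real.pi * |R|) ^ k * D (k + 2) * Real.pi := by
  have hpi := Real.pi_pos
  have hD : 0 ≤ D (k + 2) := zero_le_one.trans (h.one_le _)
  have hK := h.nonneg
  -- The constant for the whole strip uses `|R| * |x|`. It only justifies the shift; the final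
  -- estimate, taken on the line of height `R`, keeps the sign of `R * x`.
  have hs := integral_shift_eq (differentiable_jumpIntegrand h k x) (R := R)
    (C := Real.exp (2 * Real.pi * |R| * |x| + 2 * K * Real.exp (4 * Real.pi * |R|)) *
        (1 + 2 * Real.pi * |R|) ^ k * D (k + 2)) (fun η y hy => by
      have hy' : |y| ≤ |R| := by simpa using Set.abs_sub_left_of_mem_uIcc hy
      refine (norm_jumpIntegrand_le h k x η y).trans ?_
      have : y * x ≤ |R| * |x| := (le_abs_self _).trans (by rw [abs_mul]; gcongr)
      have : 2 * Real.pi * y * x ≤ 2 * Real.pi * |R| * |x| := by nlinarith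
      gcongr)
  rw [hs]
  refine (norm_integral_le_of_norm_le (integrable_inv_one_add_sq.const_mul _)
    (ae_of_all _ fun η => norm_jumpIntegrand_le h k x η R)).trans_eq ?_
  rw [integral_const_mul, integral_univ_inv_one_add_sq]

/-- A term linear in `s` is absorbed by `s² log s` once `log s ≥ 4A`; for smaller `s` it is bounded
by a constant. -/
theorem mul_le_sq_sub_one_mul_log {A s : ℝ} (hA : 0 ≤ A) (hs : 1 ≤ s) :
    A * s ≤ (s ^ 2 - 1) * Real.log s / 4 + (A * Real.exp (4 * A) + 2 * A) := by
  have h1 : 0 ≤ s ^ 2 - 1 := by nlinarith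
  rcases le_total (4 * A) (Real.log s) with h | h
  · have : 0 ≤ A * Real.exp (4 * A) := by positivity
    nlinarith [mul_le_mul_of_nonneg_left h h1, mul_nonneg hA (sq_nonneg (s - 1))]
  · have : s ≤ Real.exp (4 * A) := (Real.log_le_iff_le_exp (by linarith)).1 h
    have h2 : 0 ≤ (s ^ 2 - 1) * Real.log s := mul_nonneg h1 (Real.log_nonneg hs)
    have := mul_le_mul_of_nonneg_left this hA
    linarith

/-- The constant in the upper bound of the `k`-th derivative of the density. -/
noncomputable def jumpConst (K : ℝ) (D : ℕ → ℝ) (k : ℕ) : ℝ :=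
  k.factorial * D (k + 2) * Real.pi *
    Real.exp (1 + ((2 * K + 1) * Real.exp (4 * (2 * K + 1)) + 2 * (2 * K + 1)))

theorem IsSmallJump.jumpConst_pos (h : IsSmallJump ν K D) (k : ℕ) : 0 < jumpConst K D k := by
  have := h.one_le (k + 2)
  have hpi := Real.pi_pos
  unfold jumpConst
  positivity

theorem norm_integral_jumpIntegrand_le_fUpperSym (h : IsSmallJump ν K D) (k : ℕ) (x : ℝ) :
    ‖∫ η : ℝ, jumpIntegrand ν k x η‖ ≤ fUpperSym (jumpConst K D k) (1 / 8) x := by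
  have hpi := Real.pi_pos
  have hK := h.nonneg
  have hD := zero_le_one.trans (h.one_le (k + 2))
  -- With `r = log(1 + |x|) / 4`, the shift gains `r|x| = |x| log(1 + |x|) / 4`, while the error `2K
  -- e^{2r}` is only `2K √(1 + |x|)`. Half of the gain absorbs it, which leaves the rate `1/8`.
  set s := Real.sqrt (1 + |x|) with hs
  have hs1 : 1 ≤ s := Real.one_le_sqrt.2 (by linarith [abs_nonneg x])
  have hs2 : s ^ 2 = 1 + |x| := Real.sq_sqrt (by positivity)
  have hlog : Real.log (1 + |x|) = 2 * Real.log s := by rw [← hs2, Real.log_pow]; norm_num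
  have hls : 0 ≤ Real.log s := Real.log_nonneg hs1
  set r := Real.log s / 2 with hr
  have hr0 : 0 ≤ r := by positivity
  -- The contour moves to the side opposite to the sign of `x`.
  obtain ⟨R, hR1, hR2⟩ : ∃ R : ℝ, 2 * Real.pi * |R| = r ∧ 2 * Real.pi * R * x = -(r * |x|) := by
    rcases le_total 0 x with hx | hx
    · refine ⟨-(r / (2 * Real.pi)), ?_, ?_⟩
      · rw [abs_neg, abs_of_nonneg (by positivity)]; field_simp
      · rw [abs_of_nonneg hx]; field_simp
    · refine ⟨r / (2 * Real.pi), ?_, ?_⟩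
      · rw [abs_of_nonneg (by positivity)]; field_simp
      · rw [abs_of_nonpos hx]; field_simp
  have h2r : Real.exp (4 * Real.pi * |R|) = s := by
    rw [show 4 * Real.pi * |R| = 2 * (2 * Real.pi * |R|) by ring, hR1, hr, mul_div_cancel₀ _ two_ne_zero,
      Real.exp_log (by linarith)]
  refine (norm_integral_jumpIntegrand_le h k x R).trans ?_
  rw [h2r, hR1, hR2, fUpperSym, hlog, jumpConst]
  -- The polynomial factor costs one more `e^s`, hence the coefficient `2 * K + 1` in `jumpConst`.
  have hpow : (1 + r) ^ k ≤ k.factorial * Real.exp (1 + s) := by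
    have h1 := Real.pow_div_factorial_le_exp (1 + r) (by positivity) k
    rw [div_le_iff₀ (by positivity)] at h1
    have h2 : r ≤ s := by
      have := Real.log_le_sub_one_of_pos (show 0 < s by linarith)
      rw [hr]; linarith
    calc (1 + r) ^ k ≤ Real.exp (1 + r) * k.factorial := h1
      _ ≤ Real.exp (1 + s) * k.factorial := by gcongr
      _ = _ := mul_comm _ _
  have hexp : Real.exp (-(r * |x|) + 2 * K * s) * Real.exp (1 + s) ≤
      Real.exp (1 + ((2 * K + 1) * Real.exp (4 * (2 * K + 1)) + 2 * (2 * K + 1))) *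
        Real.exp (-(1 / 8) * |x| * (2 * Real.log s)) := by
    rw [← Real.exp_add, ← Real.exp_add, Real.exp_le_exp]
    have := mul_le_sq_sub_one_mul_log (A := 2 * K + 1) (by linarith) hs1
    rw [hs2] at this
    rw [hr]
    linarith
  calc _ ≤ Real.exp (-(r * |x|) + 2 * K * s) * (k.factorial * Real.exp (1 + s)) * D (k + 2) *
        Real.pi := by gcongr
    _ = k.factorial * D (k + 2) * Real.pi *
        (Real.exp (-(r * |x|) + 2 * K * s) * Real.exp (1 + s)) := by ring
    _ ≤ _ := mul_le_mul_of_nonneg_left hexp (by positivity)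
    _ = _ := by ring

/-! ### The density of small jumps -/

/-- The Fourier transform of the density of small jumps, in Mathlib's normalization. -/
noncomputable def jumpFourier (ν : Measure ℝ) (η : ℝ) : ℂ :=
  Complex.exp (-cosExp ν (2 * Real.pi * η))

/-- The density of small jumps. -/
noncomputable def jumpDensity (ν : Measure ℝ) (x : ℝ) : ℝ :=
  (FourierTransform.fourier (jumpFourier ν) x).re

theorem IsSmallJump.continuous_cosExp (h : IsSmallJump ν K D) : Continuous (cosExp ν) := by
  have h1 := (differentiable_cosExpC h.supp h.integrable_sq).continuous
  have : cosExp ν = fun η : ℝ => (cosExpC ν η).re := by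
    ext η; rw [cosExpC_ofReal, Complex.ofReal_re]
  rw [this]
  fun_prop

theorem IsSmallJump.continuous_jumpFourier (h : IsSmallJump ν K D) :
    Continuous (jumpFourier ν) := by
  have := h.continuous_cosExp
  unfold jumpFourier
  fun_prop

theorem norm_jumpFourier (ν : Measure ℝ) (η : ℝ) :
    ‖jumpFourier ν η‖ = Real.exp (-cosExp ν (2 * Real.pi * η)) := by
  rw [jumpFourier, Complex.norm_exp]; simp

theorem IsSmallJump.integrable_pow_mul (h : IsSmallJump ν K D) (k : ℕ) :
    Integrable (fun η : ℝ => ‖η‖ ^ k * ‖jumpFourier ν η‖) := by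
  have hc := h.continuous_jumpFourier
  refine (integrable_inv_one_add_sq.const_mul (D (k + 2))).mono'
    (by fun_prop) (ae_of_all _ fun η => ?_)
  rw [norm_mul, norm_pow, norm_norm, norm_norm, norm_jumpFourier, Real.norm_eq_abs]
  refine le_trans ?_ (h.decay_inv k η)
  have h1 : |η| ≤ 1 + |2 * Real.pi * η| := by
    rw [abs_mul, abs_of_pos Real.two_pi_pos]
    nlinarith [Real.pi_gt_three, abs_nonneg η]
  gcongr

theorem IsSmallJump.integrable_pow_smul (h : IsSmallJump ν K D) (k : ℕ) :
    Integrable (fun η : ℝ => η ^ k • jumpFourier ν η) := by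
  have hc := h.continuous_jumpFourier
  refine (h.integrable_pow_mul k).mono' (by fun_prop) (ae_of_all _ fun η => ?_)
  rw [norm_smul, norm_pow]

theorem IsSmallJump.integrable_jumpFourier (h : IsSmallJump ν K D) :
    Integrable (jumpFourier ν) := by
  simpa using h.integrable_pow_smul 0

theorem IsSmallJump.contDiff_fourier (h : IsSmallJump ν K D) :
    ContDiff ℝ (⊤ : ℕ∞) (FourierTransform.fourier (jumpFourier ν)) :=
  Real.contDiff_fourier fun n _ => h.integrable_pow_mul n

theorem IsSmallJump.iteratedDeriv_fourier (h : IsSmallJump ν K D) (k : ℕ) (x : ℝ) :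
    iteratedDeriv k (FourierTransform.fourier (jumpFourier ν)) x =
      ∫ η : ℝ, jumpIntegrand ν k x η := by
  rw [Real.iteratedDeriv_fourier (N := ⊤) (fun n _ => h.integrable_pow_smul n) le_top,
    Real.fourier_eq']
  congr 1 with η
  rw [jumpIntegrand, jumpFourier, smul_eq_mul, smul_eq_mul, ← Complex.ofReal_ofNat,
    ← Complex.ofReal_mul, ← Complex.ofReal_mul, cosExpC_ofReal, ← mul_assoc]
  congr 3
  simp
  ring

theorem IsSmallJump.contDiff_jumpDensity (h : IsSmallJump ν K D) :
    ContDiff ℝ (⊤ : ℕ∞) (jumpDensity ν) :=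
  Complex.reCLM.contDiff.comp h.contDiff_fourier

theorem IsSmallJump.abs_iteratedDeriv_le (h : IsSmallJump ν K D) (k : ℕ) (x : ℝ) :
    |iteratedDeriv k (jumpDensity ν) x| ≤ fUpperSym (jumpConst K D k) (1 / 8) x := by
  have h1 : iteratedDeriv k (jumpDensity ν) x =
      (iteratedDeriv k (FourierTransform.fourier (jumpFourier ν)) x).re := by
    have := Complex.reCLM.iteratedFDeriv_comp_left (x := x) (i := k) (n := (⊤ : ℕ∞))
      h.contDiff_fourier.contDiffAt (by exact_mod_cast le_top)
    rw [iteratedDeriv_eq_iteratedFDeriv, iteratedDeriv_eq_iteratedFDeriv]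
    change iteratedFDeriv ℝ k (Complex.reCLM ∘ _) x _ = _
    rw [this]
    rfl
  rw [h1, h.iteratedDeriv_fourier]
  exact (Complex.abs_re_le_norm _).trans (norm_integral_jumpIntegrand_le_fUpperSym h k x)

/-! ### Positivity -/

open scoped ComplexOrder in
-- The Gaussian factor makes Fubini available, and the integral becomes the convolution of `E` with
-- a Gaussian kernel.
theorem gaussian_smoothing_nonneg (E : Measure ℝ) [IsFiniteMeasure E] {δ : ℝ} (hδ : 0 < δ)
    (x : ℝ) :
    0 ≤ ∫ η : ℝ, Complex.exp (-2 * Real.pi * Complex.I * x * η) *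
      (Complex.exp (-Real.pi * δ * η ^ 2) * charFun E (2 * Real.pi * η)) := by
  have hg : Integrable (fun η : ℝ => Complex.exp (-Real.pi * δ * η ^ 2)) := by
    have := integrable_cexp_neg_mul_sq (b := (Real.pi * δ : ℝ)) (by
      simpa using mul_pos Real.pi_pos hδ)
    refine this.congr (ae_of_all _ fun η => ?_)
    push_cast
    ring_nf
  have hsw : ∫ η : ℝ, Complex.exp (-2 * Real.pi * Complex.I * x * η) *
      (Complex.exp (-Real.pi * δ * η ^ 2) * charFun E (2 * Real.pi * η)) =
      ∫ y : ℝ, (∫ η : ℝ, Complex.exp (-2 * Real.pi * Complex.I * (x - y) * η) *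
        Complex.exp (-Real.pi * δ * η ^ 2)) ∂E := by
    rw [← integral_integral_swap]
    · congr 1 with η
      rw [charFun_apply_real, ← integral_const_mul, ← integral_const_mul]
      congr 1 with y
      rw [mul_left_comm, ← Complex.exp_add, mul_comm]
      congr 2
      push_cast
      ring
    · refine (hg.comp_fst E).mono (by fun_prop) (ae_of_all _ fun p => ?_)
      simp only [Function.uncurry, norm_mul]
      have : ‖Complex.exp (-2 * Real.pi * Complex.I * (x - p.2) * p.1)‖ = 1 := by
        rw [show -2 * Real.pi * Complex.I * ((x : ℂ) - p.2) * p.1 =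
          ((-2 * Real.pi * (x - p.2) * p.1 : ℝ) : ℂ) * Complex.I by push_cast; ring]
        exact Complex.norm_exp_ofReal_mul_I _
      rw [this, one_mul]
  rw [hsw]
  have hF : ∀ y : ℝ, ∫ η : ℝ, Complex.exp (-2 * Real.pi * Complex.I * (x - y) * η) *
        Complex.exp (-Real.pi * δ * η ^ 2) =
      ((1 / δ ^ (1 / 2 : ℝ) * Real.exp (-Real.pi / δ * (x - y) ^ 2) : ℝ) : ℂ) := by
    intro y
    have h := congrFun (fourier_gaussian_pi (b := δ) (by simpa using hδ)) (x - y)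
    rw [Real.fourier_eq'] at h
    push_cast [Complex.ofReal_cpow hδ.le]
    rw [Complex.ofReal_sub] at h
    rw [← h]
    congr 1 with η
    rw [smul_eq_mul]
    congr 2
    simp
    ring
  simp_rw [hF]
  rw [integral_complex_ofReal, Complex.zero_le_real]
  exact integral_nonneg fun y => by positivity

/-- The symmetrization of a measure. -/
noncomputable def symmetrize (Q : Measure ℝ) : Measure ℝ :=
  (1 / 2 : ℝ≥0) • (Q + Q.map fun u => -u)

/-- `cosExp` sees only the even part of a measure; symmetrizing turns it into a genuine compound
Poisson exponent without any symmetry assumption on `Q`. -/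
theorem charFun_symmetrize (Q : Measure ℝ) [IsFiniteMeasure Q] (ξ : ℝ) :
    charFun (symmetrize Q) ξ = ((Q.real Set.univ - cosExp Q ξ : ℝ) : ℂ) := by
  have hi : Integrable (fun v : ℝ => Real.cos (ξ * v)) Q :=
    Integrable.of_bound (by fun_prop) 1 (ae_of_all _ fun x => Real.abs_cos_le_one _)
  have h1 : Q.real Set.univ - cosExp Q ξ = (charFun Q ξ).re := by
    have hre : (charFun Q ξ).re = ∫ v : ℝ, (Complex.exp (ξ * v * Complex.I)).re ∂Q := by
      rw [charFun_apply_real]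
      refine (integral_re (𝕜 := ℂ) (Integrable.of_bound (by fun_prop) 1 (ae_of_all _ fun x => ?_))).symm
      rw [← Complex.ofReal_mul, Complex.norm_exp_ofReal_mul_I]
    rw [hre, cosExp, integral_sub (integrable_const _) hi]
    simp only [integral_const, smul_eq_mul, mul_one, sub_sub_cancel]
    congr 1 with v
    rw [← Complex.ofReal_mul, Complex.exp_ofReal_mul_I_re]
  have h2 : charFun (Q.map fun u => -u) ξ = (starRingEnd ℂ) (charFun Q ξ) := by
    have := charFun_map_mul (μ := Q) (-1) ξ
    simp only [neg_mul, one_mul] at this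
    rw [this, charFun_neg]
  have : IsFiniteMeasure (Q.map fun u => -u) := inferInstance
  rw [symmetrize, charFun_apply_real, integral_smul_nnreal_measure, integral_add_measure,
    ← charFun_apply_real, ← charFun_apply_real, h2, Complex.add_conj, h1]
  · rw [NNReal.smul_def, Complex.real_smul]
    push_cast
    ring
  all_goals
    refine Integrable.of_bound (by fun_prop) 1 (ae_of_all _ fun x => ?_)
    rw [← Complex.ofReal_mul, Complex.norm_exp_ofReal_mul_I]

open scoped ComplexOrder in
theorem gaussian_smoothing_cosExp_nonneg_of_finite (Q : Measure ℝ) [IsFiniteMeasure Q] {δ : ℝ}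
    (hδ : 0 < δ) (x : ℝ) :
    0 ≤ ∫ η : ℝ, Complex.exp (-2 * Real.pi * Complex.I * x * η) *
      (Complex.exp (-Real.pi * δ * η ^ 2) * Complex.exp (-cosExp Q (2 * Real.pi * η))) := by
  have : IsFiniteMeasure (symmetrize Q) := by unfold symmetrize; infer_instance
  have h := gaussian_smoothing_nonneg (convExp (symmetrize Q)) hδ x
  have h2 : (0 : ℂ) ≤ ((Real.exp (-Q.real Set.univ) : ℝ) : ℂ) :=
    Complex.zero_le_real.2 (Real.exp_nonneg _)
  have h3 := mul_nonneg h2 h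
  rw [← integral_const_mul] at h3
  refine h3.trans_eq (integral_congr_ae (ae_of_all _ fun η => ?_))
  have e : Complex.exp (-cosExp Q (2 * Real.pi * η)) =
      ((Real.exp (-Q.real Set.univ) : ℝ) : ℂ) *
        charFun (convExp (symmetrize Q)) (2 * Real.pi * η) := by
    rw [charFun_convExp, charFun_symmetrize, Complex.ofReal_exp, ← Complex.exp_add]
    congr 1
    push_cast
    ring
  simp only [e]
  ring

theorem norm_exp_two_pi_mul (x η : ℝ) :
    ‖Complex.exp (-2 * Real.pi * Complex.I * x * η)‖ = 1 := by
  rw [show -2 * Real.pi * Complex.I * (x : ℂ) * η =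
    ((-2 * Real.pi * x * η : ℝ) : ℂ) * Complex.I by push_cast; ring]
  exact Complex.norm_exp_ofReal_mul_I _

theorem norm_exp_gaussian (δ η : ℝ) :
    ‖Complex.exp (-Real.pi * δ * η ^ 2)‖ = Real.exp (-(Real.pi * δ) * η ^ 2) := by
  rw [show -Real.pi * (δ : ℂ) * η ^ 2 = ((-(Real.pi * δ) * η ^ 2 : ℝ) : ℂ) by push_cast; ring,
    ← Complex.ofReal_exp, Complex.norm_real, Real.norm_of_nonneg (Real.exp_nonneg _)]

theorem norm_exp_neg_cosExp_le (Q : Measure ℝ) (η : ℝ) :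
    ‖Complex.exp (-cosExp Q η)‖ ≤ 1 := by
  rw [← Complex.ofReal_neg, ← Complex.ofReal_exp, Complex.norm_real,
    Real.norm_of_nonneg (Real.exp_nonneg _)]
  exact Real.exp_le_one_iff.2 (neg_nonpos.2 (cosExp_nonneg _ _))

theorem continuous_cosExp_of_finite (Q : Measure ℝ) [IsFiniteMeasure Q] :
    Continuous (cosExp Q) := by
  refine continuous_of_dominated (bound := fun _ => 2) (fun η => by fun_prop)
    (fun η => ae_of_all _ fun v => ?_) (integrable_const _) (ae_of_all _ fun v => by fun_prop)
  rw [Real.norm_of_nonneg (one_sub_cos_nonneg _)]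
  linarith [Real.neg_one_le_cos (η * v)]

/-- The set of jumps larger than `1 / (n + 1)`. -/
def largeJumps (n : ℕ) : Set ℝ := {v | 1 / ((n : ℝ) + 1) < |v|}

theorem measurableSet_largeJumps (n : ℕ) : MeasurableSet (largeJumps n) :=
  measurableSet_lt measurable_const (by fun_prop)

theorem isFiniteMeasure_restrict_largeJumps (hν : Integrable (fun v : ℝ => v ^ 2) ν) (n : ℕ) :
    IsFiniteMeasure (ν.restrict (largeJumps n)) := by
  have h := hν.measure_norm_ge_lt_top (ε := (1 / ((n : ℝ) + 1)) ^ 2) (by positivity)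
  refine ⟨?_⟩
  rw [Measure.restrict_apply_univ]
  refine (measure_mono fun v hv => ?_).trans_lt h
  have hv' : 1 / ((n : ℝ) + 1) < |v| := hv
  change _ ≤ ‖v ^ 2‖
  rw [norm_pow, Real.norm_eq_abs]
  gcongr

theorem tendsto_cosExp_restrict (hν : Integrable (fun v : ℝ => v ^ 2) ν) (η : ℝ) :
    Tendsto (fun n => cosExp (ν.restrict (largeJumps n)) η) atTop (𝓝 (cosExp ν η)) := by
  have hi := integrable_one_sub_cos hν η
  simp only [cosExp]
  simp_rw [← integral_indicator (measurableSet_largeJumps _)]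
  refine tendsto_integral_of_dominated_convergence _
    (fun n => (hi.1.indicator (measurableSet_largeJumps n))) hi.norm
    (fun n => ae_of_all _ fun v => norm_indicator_le_norm_self _ _) (ae_of_all _ fun v => ?_)
  rcases eq_or_ne v 0 with rfl | hv
  · refine tendsto_const_nhds.congr fun n => ?_
    by_cases h : (0 : ℝ) ∈ largeJumps n <;> simp [h]
  · refine tendsto_const_nhds.congr' ?_
    have := (tendsto_one_div_add_atTop_nhds_zero_nat (𝕜 := ℝ)).eventually_lt_const
      (abs_pos.2 hv)
    filter_upwards [this] with n hn
    rw [Set.indicator_of_mem (show v ∈ largeJumps n from hn)]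

open scoped ComplexOrder in
-- Removing the jumps below `1 / (n + 1)` leaves a finite measure; the Gaussian dominates the limit
-- `n → ∞`.
theorem gaussian_smoothing_cosExp_nonneg (hν : Integrable (fun v : ℝ => v ^ 2) ν) {δ : ℝ}
    (hδ : 0 < δ) (x : ℝ) :
    0 ≤ ∫ η : ℝ, Complex.exp (-2 * Real.pi * Complex.I * x * η) *
      (Complex.exp (-Real.pi * δ * η ^ 2) * Complex.exp (-cosExp ν (2 * Real.pi * η))) := by
  have hfin := isFiniteMeasure_restrict_largeJumps hν
  refine ge_of_tendsto' (b := (0 : ℂ)) (tendsto_integral_of_dominated_convergence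
    (F := fun n (η : ℝ) => Complex.exp (-2 * Real.pi * Complex.I * x * η) *
      (Complex.exp (-Real.pi * δ * η ^ 2) *
        Complex.exp (-cosExp (ν.restrict (largeJumps n)) (2 * Real.pi * η))))
    (fun η => Real.exp (-(Real.pi * δ) * η ^ 2)) (fun n => ?_)
    (integrable_exp_neg_mul_sq (mul_pos Real.pi_pos hδ)) (fun n => ae_of_all _ fun η => ?_)
    (ae_of_all _ fun η => ?_))
    (fun n => gaussian_smoothing_cosExp_nonneg_of_finite (ν.restrict (largeJumps n)) hδ x)
  · have := continuous_cosExp_of_finite (ν.restrict (largeJumps n))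
    exact Continuous.aestronglyMeasurable (by fun_prop)
  · rw [norm_mul, norm_mul, norm_exp_two_pi_mul, norm_exp_gaussian, one_mul]
    exact mul_le_of_le_one_right (Real.exp_nonneg _) (norm_exp_neg_cosExp_le _ _)
  · refine Tendsto.const_mul _ (Tendsto.const_mul _ ?_)
    have h1 := tendsto_cosExp_restrict hν (2 * Real.pi * η)
    exact (Complex.continuous_exp.tendsto _).comp
      ((Complex.continuous_ofReal.tendsto _).comp h1).neg

open scoped ComplexOrder in
theorem IsSmallJump.fourier_nonneg (h : IsSmallJump ν K D) (x : ℝ) :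
    0 ≤ FourierTransform.fourier (jumpFourier ν) x := by
  have hc := h.continuous_cosExp
  have e : FourierTransform.fourier (jumpFourier ν) x =
      ∫ η : ℝ, Complex.exp (-2 * Real.pi * Complex.I * x * η) *
        (1 * Complex.exp (-cosExp ν (2 * Real.pi * η))) := by
    have := h.iteratedDeriv_fourier 0 x
    rw [iteratedDeriv_zero] at this
    rw [this]
    congr 1 with η
    rw [jumpIntegrand, pow_zero, mul_one, one_mul, ← cosExpC_ofReal]
    push_cast
    rfl
  rw [e]
  -- Now the Gaussian itself is removed, with variance parameter `1 / (n + 1)`; the integrable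
  -- `jumpFourier` takes over as dominating function.
  refine ge_of_tendsto' (b := (0 : ℂ)) (tendsto_integral_of_dominated_convergence
    (F := fun (n : ℕ) (η : ℝ) => Complex.exp (-2 * Real.pi * Complex.I * x * η) *
      (Complex.exp (-Real.pi * ((1 / ((n : ℝ) + 1) : ℝ) : ℂ) * η ^ 2) *
        Complex.exp (-cosExp ν (2 * Real.pi * η))))
    (fun η => ‖jumpFourier ν η‖) (fun n => ?_)
    h.integrable_jumpFourier.norm (fun n => ae_of_all _ fun η => ?_)
    (ae_of_all _ fun η => ?_))
    (fun n => gaussian_smoothing_cosExp_nonneg h.integrable_sq Nat.one_div_pos_of_nat x)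
  · exact Continuous.aestronglyMeasurable (by fun_prop)
  · rw [norm_mul, norm_mul, norm_exp_two_pi_mul, norm_exp_gaussian, one_mul]
    refine mul_le_of_le_one_left (norm_nonneg _) (Real.exp_le_one_iff.2 ?_)
    have : 0 ≤ Real.pi * (1 / ((n : ℝ) + 1)) * η ^ 2 := by positivity
    linarith
  · refine Tendsto.const_mul _ (Tendsto.mul_const _ ?_)
    have h1 : Tendsto (fun n : ℕ => ((1 / ((n : ℝ) + 1) : ℝ) : ℂ)) atTop (𝓝 ((0 : ℝ) : ℂ)) :=
      (Complex.continuous_ofReal.tendsto _).comp tendsto_one_div_add_atTop_nhds_zero_nat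
    have h2 : Continuous fun z : ℂ => Complex.exp (-Real.pi * z * η ^ 2) := by fun_prop
    have h3 := (h2.tendsto _).comp h1
    rw [Complex.ofReal_zero, mul_zero, zero_mul, Complex.exp_zero] at h3
    exact h3

theorem IsSmallJump.ofReal_jumpDensity (h : IsSmallJump ν K D) (x : ℝ) :
    (jumpDensity ν x : ℂ) = FourierTransform.fourier (jumpFourier ν) x :=
  (Complex.eq_re_of_ofReal_le (r := 0) (by simpa using h.fourier_nonneg x)).symm

theorem IsSmallJump.jumpDensity_nonneg (h : IsSmallJump ν K D) (x : ℝ) : 0 ≤ jumpDensity ν x :=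
  (Complex.le_def.1 (h.fourier_nonneg x)).1

/-! ### Lower bound -/

/-- The value at `0` is the integral of the Fourier transform, which lies above a Gaussian because
the exponent is at most quadratic. Using `K + 1` keeps the Gaussian integrable even if `K = 0`. -/
theorem IsSmallJump.jumpDensity_zero_ge (h : IsSmallJump ν K D) :
    Real.sqrt (Real.pi / (2 * Real.pi ^ 2 * (K + 1))) ≤ jumpDensity ν 0 := by
  have hK := h.nonneg
  have e : jumpDensity ν 0 = ∫ η : ℝ, Real.exp (-cosExp ν (2 * Real.pi * η)) := by
    rw [← Complex.ofReal_inj, h.ofReal_jumpDensity, Real.fourier_eq', ← integral_complex_ofReal]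
    congr 1 with η
    simp [jumpFourier]
  rw [e, ← integral_gaussian]
  refine integral_mono (integrable_exp_neg_mul_sq (by positivity)) ?_ fun η => ?_
  · refine h.integrable_jumpFourier.norm.congr (ae_of_all _ fun η => ?_)
    exact norm_jumpFourier ν η
  · refine Real.exp_le_exp.2 ?_
    have h1 := cosExp_le h.integrable_sq (2 * Real.pi * η)
    have h2 : (2 * Real.pi * η) ^ 2 / 2 * ∫ v : ℝ, v ^ 2 ∂ν ≤
        (2 * Real.pi * η) ^ 2 / 2 * (K + 1) := by
      have := h.integral_sq_le
      gcongr
      linarith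
    nlinarith

theorem fUpperSym_le {b₁ b₂ : ℝ} (h₁ : 0 ≤ b₁) (h₂ : 0 ≤ b₂) (x : ℝ) : fUpperSym b₁ b₂ x ≤ b₁ := by
  refine mul_le_of_le_one_right h₁ (Real.exp_le_one_iff.2 ?_)
  have := mul_nonneg (mul_nonneg h₂ (abs_nonneg x))
    (Real.log_nonneg (show 1 ≤ 1 + |x| by linarith [abs_nonneg x]))
  linarith

theorem fUpperSym_nonneg {b₁ b₂ : ℝ} (h₁ : 0 ≤ b₁) (x : ℝ) : 0 ≤ fUpperSym b₁ b₂ x :=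
  mul_nonneg h₁ (Real.exp_nonneg _)

theorem IsSmallJump.abs_iteratedDeriv_le_const (h : IsSmallJump ν K D) (k : ℕ) (x : ℝ) :
    |iteratedDeriv k (jumpDensity ν) x| ≤ jumpConst K D k :=
  (h.abs_iteratedDeriv_le k x).trans (fUpperSym_le (h.jumpConst_pos k).le (by norm_num) x)

/-- The density is at least `c` at the origin and is Lipschitz with constant `M = jumpConst K D 1`,
so it stays above `c / 2` for `|x| ≤ c / (2M)`. -/
theorem IsSmallJump.fLower_le (h : IsSmallJump ν K D) (x : ℝ) :
    fLower (Real.sqrt (Real.pi / (2 * Real.pi ^ 2 * (K + 1))) / 2)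
      (Real.sqrt (Real.pi / (2 * Real.pi ^ 2 * (K + 1))) / (2 * jumpConst K D 1)) x ≤
      jumpDensity ν x := by
  set c := Real.sqrt (Real.pi / (2 * Real.pi ^ 2 * (K + 1)))
  have hM := h.jumpConst_pos 1
  rw [fLower]
  split_ifs with hx
  · have hd : ∀ y ∈ Set.univ, ‖deriv (jumpDensity ν) y‖ ≤ jumpConst K D 1 := fun y _ => by
      simpa using h.abs_iteratedDeriv_le_const 1 y
    have := convex_univ.norm_image_sub_le_of_norm_deriv_le
      (fun y _ => (h.contDiff_jumpDensity.differentiable (by simp)).differentiableAt) hd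
      (Set.mem_univ 0) (Set.mem_univ x)
    rw [sub_zero, Real.norm_eq_abs, Real.norm_eq_abs] at this
    have h2 : jumpConst K D 1 * |x| ≤ c / 2 := by
      rw [le_div_iff₀ (by positivity)] at hx
      linarith
    have h3 := h.jumpDensity_zero_ge
    have := (abs_le.1 this).1
    rw [mul_one]
    linarith
  · simpa using h.jumpDensity_nonneg x

/-! ### Characteristic function -/

theorem integrable_fUpperSym (b₁ : ℝ) {b₂ : ℝ} (h₂ : 0 < b₂) : Integrable (fUpperSym b₁ b₂) := by
  have hlog : ∀ x : ℝ, 0 ≤ Real.log (1 + |x|) := fun x =>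
    Real.log_nonneg (by linarith [abs_nonneg x])
  have hc : Continuous fun x : ℝ => Real.log (1 + |x|) :=
    Continuous.log (by fun_prop) fun x => by positivity
  have key : ∀ x : ℝ, Real.exp (-b₂ * |x| * Real.log (1 + |x|)) ≤
      2 * Real.exp (Real.exp (1 / b₂)) * (1 + x ^ 2)⁻¹ := by
    intro x
    -- Beyond `e^{1/b₂}` the logarithm exceeds `1 / b₂`, so the decay is at least exponential up to
    -- a constant.
    have h1 : |x| - Real.exp (1 / b₂) ≤ b₂ * |x| * Real.log (1 + |x|) := by
      rcases le_total (1 / b₂) (Real.log (1 + |x|)) with h | h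
      · have : |x| = b₂ * |x| * (1 / b₂) := by field_simp
        have := mul_le_mul_of_nonneg_left h (mul_nonneg h₂.le (abs_nonneg x))
        linarith [Real.exp_pos (1 / b₂)]
      · have := (Real.log_le_iff_le_exp (by positivity)).1 h
        have := mul_nonneg (mul_nonneg h₂.le (abs_nonneg x)) (hlog x)
        linarith
    have h3 : (Real.exp |x|)⁻¹ ≤ 2 * (1 + x ^ 2)⁻¹ := by
      have := Real.quadratic_le_exp_of_nonneg (abs_nonneg x)
      rw [sq_abs] at this
      rw [← div_eq_mul_inv, inv_le_comm₀ (Real.exp_pos _) (by positivity), inv_div]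
      linarith [abs_nonneg x]
    calc _ ≤ Real.exp (Real.exp (1 / b₂) + -|x|) := Real.exp_le_exp.2 (by linarith)
      _ = Real.exp (Real.exp (1 / b₂)) * (Real.exp |x|)⁻¹ := by rw [Real.exp_add, Real.exp_neg]
      _ ≤ Real.exp (Real.exp (1 / b₂)) * (2 * (1 + x ^ 2)⁻¹) := by gcongr
      _ = _ := by ring
  refine Integrable.const_mul ((integrable_inv_one_add_sq.const_mul
    (2 * Real.exp (Real.exp (1 / b₂)))).mono'
    (Continuous.aestronglyMeasurable (by fun_prop)) (ae_of_all _ fun x => ?_)) b₁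
  rw [Real.norm_of_nonneg (Real.exp_nonneg _)]
  exact key x

theorem IsSmallJump.integrable_jumpDensity (h : IsSmallJump ν K D) :
    Integrable (jumpDensity ν) := by
  refine (integrable_fUpperSym (jumpConst K D 0) (b₂ := 1 / 8) (by norm_num)).mono'
    h.contDiff_jumpDensity.continuous.aestronglyMeasurable (ae_of_all _ fun x => ?_)
  simpa using h.abs_iteratedDeriv_le 0 x

theorem IsSmallJump.integral_exp_mul_jumpDensity (h : IsSmallJump ν K D) (ξ : ℝ) :
    ∫ x : ℝ, Complex.exp (ξ * x * Complex.I) * jumpDensity ν x = Complex.exp (-cosExp ν ξ) := by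
  have hi : Integrable (FourierTransform.fourier (jumpFourier ν)) :=
    h.integrable_jumpDensity.ofReal.congr (ae_of_all _ h.ofReal_jumpDensity)
  have := congrFun (h.continuous_jumpFourier.fourierInv_fourier_eq h.integrable_jumpFourier hi)
    (ξ / (2 * Real.pi))
  rw [Real.fourierInv_eq', jumpFourier, mul_div_cancel₀ _ Real.two_pi_pos.ne'] at this
  rw [← this]
  congr 1 with x
  rw [h.ofReal_jumpDensity, smul_eq_mul]
  congr 4
  have := Real.pi_pos.ne'
  simp
  field_simp

/-! ### Convolution of a rescaled density with a finite measure -/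

/-- The convolution of `x ↦ G (ρx)` with the measure `E`. -/
noncomputable def scaledConv (G : ℝ → ℝ) (ρ : ℝ) (E : Measure ℝ) (x : ℝ) : ℝ :=
  ∫ y : ℝ, G ((x - y) * ρ) ∂E

theorem contDiff_one_iteratedDeriv {G : ℝ → ℝ} (hG : ContDiff ℝ (⊤ : ℕ∞) G) (k : ℕ) :
    ContDiff ℝ 1 (iteratedDeriv k G) := by
  rw [iteratedDeriv_eq_iterate]
  exact ContDiff.iterate_deriv' 1 k (hG.of_le (by exact_mod_cast le_top))

section ScaledConv

variable {G : ℝ → ℝ} {E : Measure ℝ} [IsFiniteMeasure E]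

theorem integrable_scaledConv {M : ℝ} (hG : Measurable G) (hM : ∀ x, |G x| ≤ M) (ρ x : ℝ) :
    Integrable (fun y : ℝ => G ((x - y) * ρ)) E :=
  Integrable.of_bound (hG.comp (by fun_prop)).aestronglyMeasurable M (ae_of_all _ fun y => hM _)

theorem hasDerivAt_scaledConv (hG : ContDiff ℝ 1 G) {M M' : ℝ} (hM : ∀ x, |G x| ≤ M)
    (hM' : ∀ x, |deriv G x| ≤ M') (ρ x : ℝ) :
    HasDerivAt (scaledConv G ρ E) (ρ * scaledConv (deriv G) ρ E x) x := by
  have hc := hG.continuous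
  have hc' := hG.continuous_deriv le_rfl
  have h := hasDerivAt_integral_of_dominated_loc_of_deriv_le (μ := E) (𝕜 := ℝ)
    (F := fun x y => G ((x - y) * ρ)) (F' := fun x y => ρ * deriv G ((x - y) * ρ))
    (bound := fun _ => |ρ| * M') (x₀ := x) univ_mem (.of_forall fun _ => by fun_prop)
    (integrable_scaledConv hc.measurable hM ρ x) (by fun_prop)
    (ae_of_all _ fun y x _ => by
      rw [Real.norm_eq_abs, abs_mul]
      exact mul_le_mul_of_nonneg_left (hM' _) (abs_nonneg _))
    (integrable_const _)
    (ae_of_all _ fun y x _ => by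
      have h1 : HasDerivAt (fun x => (x - y) * ρ) (1 * ρ) x :=
        ((hasDerivAt_id x).sub_const y).mul_const ρ
      have h2 := ((hG.differentiable one_ne_zero).differentiableAt
        (x := (x - y) * ρ)).hasDerivAt.comp x h1
      exact h2.congr_deriv (by ring))
  refine h.2.congr_deriv ?_
  rw [integral_const_mul, scaledConv]

/-- Each derivative brings out one factor `ρ`; with the prefactor of the density this yields the
power `k + 1` in the derivative estimate. -/
theorem iteratedDeriv_scaledConv (hG : ContDiff ℝ (⊤ : ℕ∞) G) {M : ℕ → ℝ}
    (hM : ∀ k x, |iteratedDeriv k G x| ≤ M k) (ρ : ℝ) (k : ℕ) :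
    iteratedDeriv k (scaledConv G ρ E) =
      fun x => ρ ^ k * scaledConv (iteratedDeriv k G) ρ E x := by
  induction k with
  | zero => ext x; simp [iteratedDeriv_zero]
  | succ k ih =>
    ext x
    rw [iteratedDeriv_succ, ih]
    have hk := contDiff_one_iteratedDeriv hG k
    have := (hasDerivAt_scaledConv (E := E) hk (hM k) (M' := M (k + 1))
      (fun x => by rw [← iteratedDeriv_succ]; exact hM (k + 1) x) ρ x).const_mul (ρ ^ k)
    rw [this.deriv, ← iteratedDeriv_succ]
    ring

theorem contDiff_scaledConv (hG : ContDiff ℝ (⊤ : ℕ∞) G) {M : ℕ → ℝ}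
    (hM : ∀ k x, |iteratedDeriv k G x| ≤ M k) (ρ : ℝ) :
    ContDiff ℝ (⊤ : ℕ∞) (scaledConv G ρ E) := by
  refine contDiff_of_differentiable_iteratedDeriv fun k _ => ?_
  rw [iteratedDeriv_scaledConv hG hM]
  have hk := contDiff_one_iteratedDeriv hG k
  exact fun x => ((hasDerivAt_scaledConv (E := E) hk (hM k) (M' := M (k + 1))
      (fun x => by rw [← iteratedDeriv_succ]; exact hM (k + 1) x) ρ x).const_mul
        (ρ ^ k)).differentiableAt

theorem integrable_prod_scaledConv (hG : Integrable G) {ρ : ℝ} (hρ : ρ ≠ 0) :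
    Integrable (fun p : ℝ × ℝ => G ((p.1 - p.2) * ρ)) (volume.prod E) := by
  have := Integrable.convolution_integrand (ContinuousLinearMap.mul ℝ ℝ) (μ := volume) (ν := E)
    (integrable_const (1 : ℝ)) (hG.comp_mul_right' hρ)
  simpa using this

theorem integrable_scaledConv_volume (hG : Integrable G) {ρ : ℝ} (hρ : ρ ≠ 0) :
    Integrable (scaledConv G ρ E) :=
  (integrable_prod_scaledConv hG hρ).integral_prod_left

theorem integral_exp_mul_scaledConv (hG : Integrable G) {ρ : ℝ} (hρ : 0 < ρ) (ξ : ℝ) :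
    ∫ x : ℝ, Complex.exp (ξ * x * Complex.I) * ((ρ * scaledConv G ρ E x : ℝ) : ℂ) =
      (∫ x : ℝ, Complex.exp ((ξ / ρ : ℝ) * x * Complex.I) * G x) * charFun E ξ := by
  have h1 : ∀ x : ℝ, Complex.exp (ξ * x * Complex.I) * ((ρ * scaledConv G ρ E x : ℝ) : ℂ) =
      ∫ y : ℝ, Complex.exp (ξ * x * Complex.I) * (ρ * (G ((x - y) * ρ) : ℂ)) ∂E := by
    intro x
    rw [integral_const_mul, integral_const_mul, integral_complex_ofReal, scaledConv,
      Complex.ofReal_mul]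
  simp_rw [h1]
  rw [integral_integral_swap]
  · rw [charFun_apply_real, ← integral_const_mul]
    congr 1 with y
    have h2 : ∀ x : ℝ, Complex.exp (ξ * x * Complex.I) * (ρ * (G ((x - y) * ρ) : ℂ)) =
        (fun s : ℝ => Complex.exp (ξ * y * Complex.I) * (ρ *
          (fun r : ℝ => Complex.exp ((ξ / ρ : ℝ) * r * Complex.I) * G r) (s * ρ))) (x - y) := by
      intro x
      have : Complex.exp (ξ * x * Complex.I) = Complex.exp (ξ * y * Complex.I) *
          Complex.exp ((ξ / ρ : ℝ) * ((x - y) * ρ : ℝ) * Complex.I) := by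
        rw [← Complex.exp_add]
        congr 1
        have : (ρ : ℂ) ≠ 0 := by exact_mod_cast hρ.ne'
        push_cast
        field_simp
        ring
      rw [this]
      ring
    simp_rw [h2]
    rw [integral_sub_right_eq_self (fun s : ℝ => Complex.exp (ξ * y * Complex.I) * (ρ *
          (fun r : ℝ => Complex.exp ((ξ / ρ : ℝ) * r * Complex.I) * G r) (s * ρ))) y,
      integral_const_mul, integral_const_mul,
      Measure.integral_comp_mul_right
        (fun r : ℝ => Complex.exp ((ξ / ρ : ℝ) * r * Complex.I) * G r) ρ,
      abs_of_pos (inv_pos.2 hρ), Complex.real_smul]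
    have : (ρ : ℂ) ≠ 0 := by exact_mod_cast hρ.ne'
    push_cast
    field_simp
  · refine (((integrable_prod_scaledConv (E := E) hG hρ.ne').ofReal (𝕜 := ℂ)).const_mul
      (ρ : ℂ)).bdd_mul (c := 1) (by fun_prop) (ae_of_all _ fun p => ?_)
    rw [← Complex.ofReal_mul, Complex.norm_exp_ofReal_mul_I]

end ScaledConv

theorem charFun_withDensity_ofReal {p : ℝ → ℝ} (hp : Measurable p) (h0 : ∀ x, 0 ≤ p x) (ξ : ℝ) :
    charFun (volume.withDensity fun x => ENNReal.ofReal (p x)) ξ =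
      ∫ x : ℝ, Complex.exp (ξ * x * Complex.I) * p x := by
  rw [charFun_apply_real, integral_withDensity_eq_integral_toReal_smul (by fun_prop)
    (ae_of_all _ fun _ => ENNReal.ofReal_lt_top)]
  congr 1 with x
  rw [ENNReal.toReal_ofReal (h0 x), Complex.real_smul, mul_comm]

/-! ### Compound kernels as integrals against the convolution exponential -/

section Compound

variable {σ h ζ : ℝ → ℝ} {Q : ℝ → Measure ℝ} {t : ℝ}

/-- For bounded `h` the series is a single integral against a finite measure, which settles
convergence and allows termwise comparison under the integral sign. -/
theorem hasSum_compoundTerm [IsFiniteMeasure (Q t)] {M : ℝ} (hm : Measurable h)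
    (hM : ∀ x, |h x| ≤ M) (x : ℝ) :
    HasSum (compoundTerm σ h ζ Q t x) (σ t * scaledConv h (ζ t) (convExp (Q t)) x) := by
  have hi := (integrable_scaledConv (E := convExp (Q t)) hm hM (ζ t) x).const_mul (σ t)
  have := hasSum_integral_convExp _ hi
  rwa [integral_const_mul] at this

theorem compoundKernelConverges [IsFiniteMeasure (Q t)] {M : ℝ} (hm : Measurable h)
    (hM : ∀ x, |h x| ≤ M) (x : ℝ) : CompoundKernelConverges σ h ζ Q t x :=
  ⟨inferInstance, fun _ => (integrable_scaledConv hm hM (ζ t) x).const_mul (σ t),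
    (hasSum_compoundTerm hm hM x).summable⟩

end Compound

theorem measurable_fUpperSym (b₁ b₂ : ℝ) : Measurable (fUpperSym b₁ b₂) := by
  unfold fUpperSym
  fun_prop

theorem measurable_fLower (b₃ b₄ : ℝ) : Measurable (fLower b₃ b₄) :=
  (Measurable.ite (measurableSet_le (by fun_prop) measurable_const) measurable_const
    measurable_const).const_mul b₃

theorem abs_fLower_le {b₃ : ℝ} (h : 0 ≤ b₃) (b₄ x : ℝ) : |fLower b₃ b₄ x| ≤ b₃ := by
  rw [fLower]
  split_ifs <;> simp [abs_of_nonneg h, h]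

/-! ### Consequences of condition A -/

variable {μ : Measure ℝ}

theorem integrable_min_one_sq (hμ : IsLevyMeasure μ) :
    Integrable (fun u : ℝ => min 1 (u ^ 2)) μ := by
  refine ⟨by fun_prop, ?_⟩
  rw [hasFiniteIntegral_iff_ofReal (ae_of_all _ fun u => by positivity)]
  exact hμ.2

theorem integrable_min_sq_one (hμ : IsLevyMeasure μ) (ξ : ℝ) :
    Integrable (fun u : ℝ => min ((ξ * u) ^ 2) 1) μ := by
  refine ((integrable_min_one_sq hμ).const_mul (1 + ξ ^ 2)).mono' (by fun_prop)
    (ae_of_all _ fun u => ?_)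
  rw [Real.norm_of_nonneg (by positivity)]
  rcases le_total 1 (u ^ 2) with h | h
  · rw [min_eq_left h]
    exact (min_le_right _ _).trans (by nlinarith [sq_nonneg ξ])
  · rw [min_eq_right h]
    exact (min_le_left _ _).trans (by nlinarith [sq_nonneg u])

theorem measurable_psiL_integrand (ξ : ℝ) :
    Measurable fun u : ℝ => if |ξ * u| < 1 then (ξ * u) ^ 2 else 0 :=
  Measurable.ite (measurableSet_lt (by fun_prop) measurable_const) (by fun_prop) measurable_const

theorem integrable_psiL (hμ : IsLevyMeasure μ) (ξ : ℝ) :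
    Integrable (fun u : ℝ => if |ξ * u| < 1 then (ξ * u) ^ 2 else 0) μ := by
  refine (integrable_min_sq_one hμ ξ).mono' (measurable_psiL_integrand ξ).aestronglyMeasurable
    (ae_of_all _ fun u => ?_)
  split_ifs with h
  · rw [Real.norm_of_nonneg (by positivity), min_eq_left]
    exact (sq_lt_one_iff_abs_lt_one _).2 h |>.le
  · rw [norm_zero]; positivity

theorem one_sub_cos_le_min (x : ℝ) : 1 - Real.cos x ≤ 2 * min (x ^ 2) 1 := by
  rcases le_total (x ^ 2) 1 with h | h
  · rw [min_eq_left h]; linarith [one_sub_cos_le x, sq_nonneg x]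
  · rw [min_eq_right h]; linarith [Real.neg_one_le_cos x]

theorem sq_le_one_sub_cos {x : ℝ} (hx : |x| ≤ 1) : x ^ 2 ≤ 3 * (1 - Real.cos x) := by
  have h := (abs_le.1 (Real.cos_bound hx)).2
  have h2 : |x| ^ 4 ≤ x ^ 2 := by
    rw [← sq_abs x]
    exact pow_le_pow_of_le_one (abs_nonneg x) hx (by norm_num)
  linarith [sq_nonneg x]

theorem integrable_one_sub_cos_levy (hμ : IsLevyMeasure μ) (ξ : ℝ) :
    Integrable (fun u : ℝ => 1 - Real.cos (ξ * u)) μ := by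
  refine ((integrable_min_sq_one hμ ξ).const_mul 2).mono' (by fun_prop) (ae_of_all _ fun u => ?_)
  rw [Real.norm_of_nonneg (one_sub_cos_nonneg _)]
  exact one_sub_cos_le_min _

theorem cosExp_le_psiU (hμ : IsLevyMeasure μ) (ξ : ℝ) : cosExp μ ξ ≤ 2 * psiU μ ξ := by
  rw [psiU, ← integral_const_mul]
  exact integral_mono (integrable_one_sub_cos_levy hμ ξ) ((integrable_min_sq_one hμ ξ).const_mul 2)
    fun u => one_sub_cos_le_min _

theorem psiL_le_cosExp (hμ : IsLevyMeasure μ) (ξ : ℝ) : psiL μ ξ ≤ 3 * cosExp μ ξ := by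
  rw [cosExp, ← integral_const_mul]
  refine integral_mono (integrable_psiL hμ ξ) ((integrable_one_sub_cos_levy hμ ξ).const_mul 3)
    fun u => ?_
  simp only
  split_ifs with h
  · exact sq_le_one_sub_cos h.le
  · linarith [one_sub_cos_nonneg (ξ * u)]

theorem psiU_nonneg (μ : Measure ℝ) (ξ : ℝ) : 0 ≤ psiU μ ξ :=
  integral_nonneg fun u => by positivity

theorem psiU_mono (hμ : IsLevyMeasure μ) {ξ η : ℝ} (h : |ξ| ≤ |η|) : psiU μ ξ ≤ psiU μ η := by
  refine integral_mono (integrable_min_sq_one hμ ξ) (integrable_min_sq_one hμ η) fun u => ?_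
  refine min_le_min_right _ ?_
  rw [mul_pow, mul_pow]
  exact mul_le_mul_of_nonneg_right (sq_le_sq.2 h) (sq_nonneg u)

/-- Where `|2ξu| < 1` both minima are the squares, and passing from `ξ` to `2ξ` gains three quarters
of the larger one; elsewhere monotonicity suffices. -/
theorem psiL_two_mul_le (hμ : IsLevyMeasure μ) (ξ : ℝ) :
    3 / 4 * psiL μ (2 * ξ) ≤ psiU μ (2 * ξ) - psiU μ ξ := by
  rw [psiL, psiU, psiU, ← integral_sub (integrable_min_sq_one hμ _) (integrable_min_sq_one hμ _),
    ← integral_const_mul]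
  refine integral_mono ((integrable_psiL hμ _).const_mul _)
    ((integrable_min_sq_one hμ _).sub (integrable_min_sq_one hμ _)) fun u => ?_
  have e : (2 * ξ * u) ^ 2 = 4 * (ξ * u) ^ 2 := by ring
  simp only
  split_ifs with h
  · have h1 := (sq_lt_one_iff_abs_lt_one _).2 h
    rw [min_eq_left h1.le, min_eq_left (by rw [e] at h1; linarith [sq_nonneg (ξ * u)]), e]
    linarith
  · rw [mul_zero, sub_nonneg]
    exact min_le_min_right _ (by rw [e]; linarith [sq_nonneg (ξ * u)])

/-- `psiU` grows geometrically along powers of two. -/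
theorem psiU_two_pow (hμ : IsLevyMeasure μ) {β : ℝ} (hβ : 1 < β)
    (hA : ∀ ξ, psiU μ ξ ≤ β * psiL μ ξ) (ξ : ℝ) (n : ℕ) :
    (1 + 3 / (4 * β)) ^ n * psiU μ ξ ≤ psiU μ (2 ^ n * ξ) := by
  have hβ0 : 0 < β := by linarith
  -- Condition A at `2s` makes the increment of `psiU` a fixed fraction of its value.
  have hstep : ∀ s, (1 + 3 / (4 * β)) * psiU μ s ≤ psiU μ (2 * s) := fun s => by
    have h1 := psiL_two_mul_le hμ s
    have h2 := hA (2 * s)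
    have h4 : psiU μ s ≤ psiU μ (2 * s) := psiU_mono hμ (by
      rw [abs_mul, abs_two]; linarith [abs_nonneg s])
    have h3 : 3 / (4 * β) * psiU μ (2 * s) ≤ 3 / 4 * psiL μ (2 * s) := by
      calc 3 / (4 * β) * psiU μ (2 * s) ≤ 3 / (4 * β) * (β * psiL μ (2 * s)) := by gcongr
        _ = _ := by field_simp
    have h5 : 3 / (4 * β) * psiU μ s ≤ 3 / (4 * β) * psiU μ (2 * s) := by gcongr
    linarith
  induction n with
  | zero => simp
  | succ n ih =>
    calc (1 + 3 / (4 * β)) ^ (n + 1) * psiU μ ξ =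
        (1 + 3 / (4 * β)) * ((1 + 3 / (4 * β)) ^ n * psiU μ ξ) := by ring
      _ ≤ (1 + 3 / (4 * β)) * psiU μ (2 ^ n * ξ) := by gcongr
      _ ≤ psiU μ (2 * (2 ^ n * ξ)) := hstep _
      _ = _ := by rw [← mul_assoc, ← pow_succ']

/-- The constant bounding `(1 + |η|) ^ k * exp (-cosExp ν η)` for the rescaled small jumps. -/
noncomputable def decayConst (β : ℝ) (k : ℕ) : ℝ :=
  Real.exp (6 * β + 2 * k * Real.log 2 +
    (k * Real.log 2) ^ 2 / (4 * (1 / (6 * β) * (3 / (8 * β + 3)) ^ 2)))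

theorem exists_two_pow_le {η : ℝ} (hη : 1 ≤ η) : ∃ n : ℕ, 2 ^ n ≤ η ∧ η < 2 ^ (n + 1) :=
  exists_nat_pow_near hη one_lt_two

/-- On the dyadic scale `n` the power costs an exponent linear in `n`. Geometric growth of `Φ` is
more than needed: a quadratic lower bound in `n` suffices, and completing the square gives the
constant. -/
theorem pow_mul_exp_neg_le {β : ℝ} (hβ : 1 < β) {n : ℕ} {x Φ : ℝ} (hx : 0 ≤ x)
    (hx2 : x ≤ 2 ^ (n + 1)) (hΦ : (1 + 3 / (4 * β)) ^ n / (6 * β) - 6 * β ≤ Φ) (k : ℕ) :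
    (1 + x) ^ k * Real.exp (-Φ) ≤ decayConst β k := by
  have hβ0 : 0 < β := by linarith
  -- Chosen so that `3 / (4β) = 2d + 3d / (4β)`, whence `(1 + d)² ≤ 1 + 3 / (4β)`; Bernoulli's
  -- inequality then yields `(nd)²`.
  set d := 3 / (8 * β + 3) with hd
  have hd0 : 0 < d := by positivity
  have hd1 : (1 + d) ^ 2 ≤ 1 + 3 / (4 * β) := by
    have e1 : 3 / (4 * β) = 2 * d + 3 * d / (4 * β) := by rw [hd]; field_simp; ring
    have e2 : d ≤ 3 / (4 * β) := by
      rw [hd]; exact div_le_div_of_nonneg_left (by norm_num) (by positivity) (by linarith)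
    have : d ^ 2 ≤ 3 * d / (4 * β) := by
      calc d ^ 2 = d * d := sq d
        _ ≤ d * (3 / (4 * β)) := by gcongr
        _ = _ := by ring
    linarith
  have hd2 : (n * d) ^ 2 ≤ (1 + 3 / (4 * β)) ^ n := by
    have hb := one_add_mul_le_pow (by linarith : (-2 : ℝ) ≤ d) n
    calc (n * d) ^ 2 ≤ ((1 + d) ^ n) ^ 2 := by gcongr; linarith
      _ = ((1 + d) ^ 2) ^ n := by rw [← pow_mul, ← pow_mul, mul_comm]
      _ ≤ _ := by gcongr
  have h1 : 1 + x ≤ 2 ^ (n + 2) := by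
    have : (1 : ℝ) ≤ 2 ^ (n + 1) := one_le_pow₀ one_le_two
    rw [pow_succ]; linarith
  have h2 : (1 + x) ^ k ≤ Real.exp (k * ((n + 2) * Real.log 2)) := by
    calc (1 + x) ^ k ≤ (2 ^ (n + 2)) ^ k := by gcongr
      _ = _ := by
        rw [Real.exp_nat_mul]
        congr 1
        have := Real.exp_nat_mul (Real.log 2) (n + 2)
        rw [Real.exp_log two_pos] at this
        rw [← this]
        push_cast
        rfl
  calc _ ≤ Real.exp (k * ((n + 2) * Real.log 2)) * Real.exp (-Φ) := by gcongr
    _ = Real.exp (k * ((n + 2) * Real.log 2) - Φ) := by rw [← Real.exp_add]; rfl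
    _ ≤ _ := by
      refine Real.exp_le_exp.2 ?_
      set A := k * Real.log 2 with hA
      set c := 1 / (6 * β) * d ^ 2 with hc
      have hc0 : 0 < c := by positivity
      have h3 : n * A ≤ c * n ^ 2 + A ^ 2 / (4 * c) := by
        have : c * n ^ 2 + A ^ 2 / (4 * c) - n * A = (2 * c * n - A) ^ 2 / (4 * c) := by
          field_simp; ring
        have : 0 ≤ (2 * c * n - A) ^ 2 / (4 * c) := by positivity
        linarith
      have h4 : c * n ^ 2 ≤ (1 + 3 / (4 * β)) ^ n / (6 * β) := by
        calc c * n ^ 2 = (n * d) ^ 2 / (6 * β) := by rw [hc]; ring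
          _ ≤ _ := by gcongr
      have h5 : k * ((n + 2) * Real.log 2) = n * A + 2 * A := by rw [hA]; ring
      have h6 : 2 * k * Real.log 2 = 2 * A := by rw [hA]; ring
      rw [h5, h6]
      linarith

/-- Infinite mass serves only to make `μ` nonzero, so that `psiU μ 1 > 0`; condition A does the
rest. -/
theorem tendsto_psiU_atTop (hμ : IsLevyMeasure μ) (hinf : μ Set.univ = ∞) {β : ℝ} (hβ : 1 < β)
    (hA : ∀ ξ, psiU μ ξ ≤ β * psiL μ ξ) :
    Tendsto (fun n : ℕ => psiU μ (2 ^ n)) atTop atTop := by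
  have hpos : 0 < psiU μ 1 := by
    refine (psiU_nonneg μ 1).lt_of_ne' fun h0 => ?_
    have hae := (integral_eq_zero_iff_of_nonneg (fun u => by positivity)
      (integrable_min_sq_one hμ 1)).1 h0
    have : ∀ᵐ u ∂μ, u ∈ (∅ : Set ℝ) := by
      have hz : ∀ᵐ u ∂μ, u ≠ 0 := by
        rw [ae_iff]; simpa using hμ.1
      filter_upwards [hae, hz] with u hu hu0
      have : 0 < min ((1 * u) ^ 2) 1 := by positivity
      exact absurd hu this.ne'
    have : μ Set.univ = 0 := by
      rw [ae_iff] at this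
      simpa using this
    simp [this] at hinf
  have h1 : Tendsto (fun n : ℕ => (1 + 3 / (4 * β)) ^ n * psiU μ 1) atTop atTop := by
    refine Tendsto.atTop_mul_const hpos (tendsto_pow_atTop_atTop_of_one_lt ?_)
    have : 0 < 3 / (4 * β) := by positivity
    linarith
  exact tendsto_atTop_mono (fun n => by simpa using psiU_two_pow hμ hβ hA 1 n) h1

theorem continuous_cosExp_levy (hμ : IsLevyMeasure μ) : Continuous (cosExp μ) := by
  rw [continuous_iff_continuousAt]
  intro ξ₀
  refine continuousAt_of_dominated (bound := fun u => 2 * min (((|ξ₀| + 1) * u) ^ 2) 1)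
    (.of_forall fun ξ => by fun_prop) ?_ ((integrable_min_sq_one hμ _).const_mul 2)
    (ae_of_all _ fun u => by fun_prop)
  filter_upwards [Metric.ball_mem_nhds ξ₀ one_pos] with ξ hξ
  refine ae_of_all _ fun u => ?_
  rw [Real.norm_of_nonneg (one_sub_cos_nonneg _)]
  refine (one_sub_cos_le_min _).trans ?_
  have : |ξ| ≤ |(|ξ₀| + 1)| := by
    rw [abs_of_nonneg (by positivity : 0 ≤ |ξ₀| + 1)]
    have h := abs_sub_abs_le_abs_sub ξ ξ₀
    rw [Metric.mem_ball, Real.dist_eq] at hξ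
    linarith
  have : (ξ * u) ^ 2 ≤ ((|ξ₀| + 1) * u) ^ 2 := by
    rw [mul_pow, mul_pow]
    exact mul_le_mul_of_nonneg_right (sq_le_sq.2 this) (sq_nonneg u)
  gcongr

/-! ### Symmetry of the Lévy measure -/

section Symmetry

variable {μ : Measure ℝ}

theorem integrable_charExponent (hμ : IsLevyMeasure μ) (ξ : ℝ) :
    Integrable (fun u : ℝ => 1 - Complex.exp (Complex.I * ξ * u) +
      (if |u| < 1 then Complex.I * ξ * u else 0)) μ := by
  have hm : Measurable fun u : ℝ => 1 - Complex.exp (Complex.I * ξ * u) +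
      (if |u| < 1 then Complex.I * ξ * u else 0) :=
    Measurable.add (by fun_prop) (Measurable.ite
      (measurableSet_lt (by fun_prop) measurable_const) (by fun_prop) measurable_const)
  refine ((integrable_min_one_sq hμ).const_mul (2 + ξ ^ 2 * Real.exp |ξ|)).mono'
    hm.aestronglyMeasurable (ae_of_all _ fun u => ?_)
  split_ifs with hu
  · have hu2 := (sq_lt_one_iff_abs_lt_one u).2 hu
    rw [min_eq_right hu2.le]
    have h := Complex.norm_exp_sub_sum_le_norm_mul_exp (Complex.I * ξ * u) 2
    have e : Complex.exp (Complex.I * ξ * u) -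
        ∑ m ∈ Finset.range 2, (Complex.I * ξ * u) ^ m / (m.factorial : ℂ) =
        -(1 - Complex.exp (Complex.I * ξ * u) + Complex.I * ξ * u) := by
      simp [Finset.sum_range_succ]; ring
    rw [e, norm_neg, norm_mul, norm_mul, Complex.norm_I, one_mul, Complex.norm_real,
      Complex.norm_real, Real.norm_eq_abs, Real.norm_eq_abs, mul_pow, sq_abs, sq_abs] at h
    refine h.trans ?_
    have h2 : Real.exp (|ξ| * |u|) ≤ Real.exp |ξ| :=
      Real.exp_le_exp.2 (mul_le_of_le_one_right (abs_nonneg _) hu.le)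
    calc ξ ^ 2 * u ^ 2 * Real.exp (|ξ| * |u|) ≤ ξ ^ 2 * u ^ 2 * Real.exp |ξ| := by gcongr
      _ ≤ (2 + ξ ^ 2 * Real.exp |ξ|) * u ^ 2 := by nlinarith [sq_nonneg u]
  · have hu2 : 1 ≤ u ^ 2 := by
      rw [← sq_abs]; exact one_le_pow₀ (not_lt.1 hu)
    rw [min_eq_left hu2, add_zero]
    have h1 : ‖Complex.exp (Complex.I * ξ * u)‖ = 1 := by
      rw [show Complex.I * ξ * u = ((ξ * u : ℝ) : ℂ) * Complex.I by push_cast; ring]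
      exact Complex.norm_exp_ofReal_mul_I _
    have h2 := norm_sub_le (1 : ℂ) (Complex.exp (Complex.I * ξ * u))
    rw [h1, norm_one] at h2
    have : 0 ≤ ξ ^ 2 * Real.exp |ξ| := by positivity
    linarith

theorem re_charExponent (hμ : IsLevyMeasure μ) (a ξ : ℝ) :
    (charExponent a μ ξ).re = cosExp μ ξ := by
  have h := integral_re (𝕜 := ℂ) (integrable_charExponent hμ ξ)
  rw [charExponent, Complex.add_re]
  have h0 : (Complex.I * a * ξ).re = 0 := by simp
  rw [h0, zero_add]
  refine h.symm.trans ?_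
  rw [cosExp]
  congr 1 with u
  have e : Complex.I * ξ * u = ((ξ * u : ℝ) : ℂ) * Complex.I := by push_cast; ring
  change (1 - Complex.exp (Complex.I * ξ * u) + (if |u| < 1 then Complex.I * ξ * u else 0)).re = _
  rw [e, Complex.add_re, Complex.sub_re, Complex.exp_ofReal_mul_I_re]
  split_ifs <;> simp

/-- Second differences of the exponent do not see the drift or the compensator. -/
theorem charExponent_second_difference (hμ : IsLevyMeasure μ) (a ξ h : ℝ) :
    charExponent a μ (ξ + h) + charExponent a μ (ξ - h) - 2 * charExponent a μ ξ =
      ∫ u : ℝ, Complex.exp (ξ * u * Complex.I) * ((2 * (1 - Real.cos (h * u)) : ℝ) : ℂ) ∂μ := by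
  have i1 := integrable_charExponent hμ (ξ + h)
  have i2 := integrable_charExponent hμ (ξ - h)
  have i3 := (integrable_charExponent hμ ξ).const_mul 2
  have e : ∀ u : ℝ, Complex.exp (ξ * u * Complex.I) * ((2 * (1 - Real.cos (h * u)) : ℝ) : ℂ) =
      (1 - Complex.exp (Complex.I * (ξ + h : ℝ) * u) +
        (if |u| < 1 then Complex.I * (ξ + h : ℝ) * u else 0)) +
      (1 - Complex.exp (Complex.I * (ξ - h : ℝ) * u) +
        (if |u| < 1 then Complex.I * (ξ - h : ℝ) * u else 0)) -
      2 * (1 - Complex.exp (Complex.I * ξ * u) +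
        (if |u| < 1 then Complex.I * ξ * u else 0)) := by
    intro u
    have e1 : Complex.exp (Complex.I * (ξ + h : ℝ) * u) =
        Complex.exp (ξ * u * Complex.I) * Complex.exp ((h * u : ℝ) * Complex.I) := by
      rw [← Complex.exp_add]; push_cast; ring_nf
    have e2 : Complex.exp (Complex.I * (ξ - h : ℝ) * u) =
        Complex.exp (ξ * u * Complex.I) * Complex.exp (-(h * u : ℝ) * Complex.I) := by
      rw [← Complex.exp_add]; push_cast; ring_nf
    have e3 : Complex.exp (Complex.I * ξ * u) = Complex.exp (ξ * u * Complex.I) := by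
      congr 1; ring
    rw [e1, e2, e3, Complex.ofReal_mul, Complex.ofReal_sub, Complex.ofReal_cos, Complex.cos]
    split_ifs <;> · push_cast; ring
  simp_rw [e]
  rw [integral_sub (by exact i1.add i2) i3, integral_add i1 i2, integral_const_mul]
  simp only [charExponent]
  push_cast
  ring

/-- A weight vanishing only at `0` which makes a Lévy measure finite. -/
noncomputable def symWeight (u : ℝ) : ℝ := (1 - Real.cos u) + (1 - Real.cos (Real.sqrt 2 * u))

theorem continuous_symWeight : Continuous symWeight := by unfold symWeight; fun_prop

theorem symWeight_nonneg (u : ℝ) : 0 ≤ symWeight u :=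
  add_nonneg (one_sub_cos_nonneg _) (one_sub_cos_nonneg _)

theorem symWeight_neg (u : ℝ) : symWeight (-u) = symWeight u := by simp [symWeight]

/-- A common zero of the two terms other than `0` would make `√2` rational. -/
theorem symWeight_ne_zero {u : ℝ} (hu : u ≠ 0) : symWeight u ≠ 0 := by
  intro h
  have h1 := one_sub_cos_nonneg u
  have h2 := one_sub_cos_nonneg (Real.sqrt 2 * u)
  rw [symWeight] at h
  obtain ⟨m, hm⟩ := (Real.cos_eq_one_iff u).1 (by linarith)
  obtain ⟨n, hn⟩ := (Real.cos_eq_one_iff (Real.sqrt 2 * u)).1 (by linarith)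
  have hpi := Real.two_pi_pos
  have hm0 : (m : ℝ) ≠ 0 := by
    rintro h0
    rw [h0, zero_mul] at hm
    exact hu hm.symm
  have : Real.sqrt 2 = ((n / m : ℚ) : ℝ) := by
    push_cast
    rw [eq_div_iff hm0]
    refine mul_right_cancel₀ hpi.ne' ?_
    rw [mul_assoc, hm, hn]
  exact irrational_sqrt_two ⟨_, this.symm⟩

theorem integrable_symWeight (hμ : IsLevyMeasure μ) : Integrable symWeight μ := by
  have h1 := integrable_one_sub_cos_levy hμ 1
  simp only [one_mul] at h1
  exact h1.add (integrable_one_sub_cos_levy hμ (Real.sqrt 2))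

/-- The weighted measure is finite, and its characteristic function is a combination of second
differences of the exponent with steps `1` and `√2`. It is therefore real, and a finite measure with
real characteristic function is symmetric. -/
theorem map_neg_withDensity_symWeight (hμ : IsLevyMeasure μ) {a : ℝ}
    (him : ∀ ξ, (charExponent a μ ξ).im = 0) :
    (μ.withDensity fun u => ENNReal.ofReal (symWeight u)).map (fun u => -u) =
      μ.withDensity fun u => ENNReal.ofReal (symWeight u) := by
  set ν := μ.withDensity fun u => ENNReal.ofReal (symWeight u) with hν
  have hfin : IsFiniteMeasure ν := isFiniteMeasure_withDensity_ofReal (integrable_symWeight hμ).2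
  have hc := continuous_symWeight
  refine Measure.ext_of_charFun ?_
  ext ξ
  have hneg := charFun_map_mul (μ := ν) (-1) ξ
  simp only [neg_mul, one_mul] at hneg
  rw [hneg, charFun_neg, Complex.conj_eq_iff_im]
  have him2 : ∀ h : ℝ, (∫ u : ℝ, Complex.exp (ξ * u * Complex.I) *
      ((2 * (1 - Real.cos (h * u)) : ℝ) : ℂ) ∂μ).im = 0 := by
    intro h
    rw [← charExponent_second_difference hμ a ξ h, Complex.sub_im, Complex.add_im,
      ← Complex.ofReal_ofNat, Complex.im_ofReal_mul, him, him, him]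
    simp
  have hint : ∀ h : ℝ, Integrable (fun u : ℝ => Complex.exp (ξ * u * Complex.I) *
      ((2 * (1 - Real.cos (h * u)) : ℝ) : ℂ)) μ := fun h => by
    refine (((integrable_one_sub_cos_levy hμ h).const_mul 2).ofReal (𝕜 := ℂ)).bdd_mul (c := 1)
      (by fun_prop) (ae_of_all _ fun u => ?_)
    rw [← Complex.ofReal_mul, Complex.norm_exp_ofReal_mul_I]
  have e : charFun ν ξ = ((1 / 2 : ℝ) : ℂ) *
      ((∫ u : ℝ, Complex.exp (ξ * u * Complex.I) * ((2 * (1 - Real.cos (1 * u)) : ℝ) : ℂ) ∂μ) +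
      ∫ u : ℝ, Complex.exp (ξ * u * Complex.I) *
        ((2 * (1 - Real.cos (Real.sqrt 2 * u)) : ℝ) : ℂ) ∂μ) := by
    rw [charFun_apply_real, hν, integral_withDensity_eq_integral_toReal_smul (by fun_prop)
      (ae_of_all _ fun _ => ENNReal.ofReal_lt_top), ← integral_add (hint _) (hint _),
      ← integral_const_mul]
    congr 1 with u
    rw [ENNReal.toReal_ofReal (symWeight_nonneg u), Complex.real_smul, symWeight, one_mul]
    push_cast
    ring
  rw [e, Complex.im_ofReal_mul, Complex.add_im, him2, him2]
  simp

/-- If the exponent is real, the Lévy measure integrates odd functions to zero. -/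
theorem integral_eq_zero_of_odd (hμ : IsLevyMeasure μ) {a : ℝ}
    (him : ∀ ξ, (charExponent a μ ξ).im = 0) {f : ℝ → ℝ} (hf : ∀ u, f (-u) = -f u) :
    ∫ u, f u ∂μ = 0 := by
  have hc := continuous_symWeight
  have h0 : f 0 = 0 := by have := hf 0; rw [neg_zero] at this; linarith
  -- Dividing by the even, nonvanishing weight transfers the symmetry back to `μ`; at the origin `f`
  -- vanishes.
  have e : ∫ u, f u ∂μ =
      ∫ u, f u / symWeight u ∂(μ.withDensity fun u => ENNReal.ofReal (symWeight u)) := by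
    rw [integral_withDensity_eq_integral_toReal_smul (by fun_prop)
      (ae_of_all _ fun _ => ENNReal.ofReal_lt_top)]
    congr 1 with u
    rw [ENNReal.toReal_ofReal (symWeight_nonneg u), smul_eq_mul]
    rcases eq_or_ne u 0 with rfl | hu
    · simp [h0]
    · rw [mul_div_cancel₀ _ (symWeight_ne_zero hu)]
  have h2 := integral_map_equiv (MeasurableEquiv.neg ℝ) (fun u => f u / symWeight u)
    (μ := μ.withDensity fun u => ENNReal.ofReal (symWeight u))
  have h3 : Measure.map (MeasurableEquiv.neg ℝ)
      (μ.withDensity fun u => ENNReal.ofReal (symWeight u)) =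
      μ.withDensity fun u => ENNReal.ofReal (symWeight u) := map_neg_withDensity_symWeight hμ him
  rw [h3] at h2
  have h4 : ∀ u, f (MeasurableEquiv.neg ℝ u) / symWeight (MeasurableEquiv.neg ℝ u) =
      -(f u / symWeight u) := fun u => by
    change f (-u) / symWeight (-u) = _
    rw [hf, symWeight_neg, neg_div]
  simp_rw [h4] at h2
  rw [integral_neg] at h2
  rw [e]
  linarith

end Symmetry

/-- Real characteristic functions give `sin (t Im ψ) = 0` for all `t ≥ 0`, which fails at `t = π /
(2 |Im ψ|)` unless `Im ψ = 0`. -/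
theorem im_eq_zero_of_symmetric {Ω : Type*} [MeasurableSpace Ω] {P : Measure Ω}
    {Z : ℝ≥0 → Ω → ℝ} (hZ : ∀ t, Measurable (Z t)) {ψ : ℝ → ℂ} (hψ : HasCharExponent Z P ψ)
    (hs : IsSymmetricProcess Z P) (ξ : ℝ) : (ψ ξ).im = 0 := by
  have key : ∀ t : ℝ≥0, Real.sin (t * (ψ ξ).im) = 0 := by
    intro t
    have h1 : charFun (P.map (Z t)) ξ = (starRingEnd ℂ) (charFun (P.map (Z t)) ξ) := by
      have h2 := charFun_map_mul (μ := P.map (Z t)) (-1) ξ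
      simp only [neg_mul, one_mul] at h2
      rw [Measure.map_map measurable_neg (hZ t)] at h2
      have h3 : P.map ((fun x => -x) ∘ Z t) = P.map (Z t) := hs t
      rw [h3, charFun_neg] at h2
      exact h2
    have h2 := Complex.conj_eq_iff_im.1 h1.symm
    rw [hψ, Complex.exp_im] at h2
    have h3 : (-((t : ℝ) : ℂ) * ψ ξ).im = -(t * (ψ ξ).im) := by
      rw [← Complex.ofReal_neg, Complex.im_ofReal_mul]; ring
    rw [h3, Real.sin_neg, mul_neg, neg_eq_zero] at h2
    exact (mul_eq_zero.1 h2).resolve_left (Real.exp_pos _).ne'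
  by_contra hne
  have hpos := abs_pos.2 hne
  have h : Real.sin (Real.pi / 2 / |(ψ ξ).im| * (ψ ξ).im) = 0 :=
    key ⟨Real.pi / 2 / |(ψ ξ).im|, by positivity⟩
  rcases abs_choice (ψ ξ).im with h1 | h1
  · rw [h1, div_mul_cancel₀ _ hne, Real.sin_pi_div_two] at h
    exact one_ne_zero h
  · rw [h1, div_neg, neg_mul, div_mul_cancel₀ _ hne, Real.sin_neg, Real.sin_pi_div_two] at h
    norm_num at h

/-! ### The scale `rho` and the decomposition of the jumps -/

section Decomposition

variable {μ : Measure ℝ}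

theorem psiU_le_cosExp (hμ : IsLevyMeasure μ) {β : ℝ} (hβ : 1 < β)
    (hA : ∀ ξ, psiU μ ξ ≤ β * psiL μ ξ) (ξ : ℝ) : psiU μ ξ ≤ 3 * β * cosExp μ ξ := by
  have h1 := psiL_le_cosExp hμ ξ
  have h2 := hA ξ
  nlinarith

theorem rho_pos_and_cosExp_rho (hμ : IsLevyMeasure μ) (hinf : μ Set.univ = ∞) {β : ℝ} (hβ : 1 < β)
    (hA : ∀ ξ, psiU μ ξ ≤ β * psiL μ ξ) (a : ℝ) {t : ℝ} (ht : 0 < t) :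
    0 < rho (charExponent a μ) t ∧ t * cosExp μ (rho (charExponent a μ) t) = 1 := by
  have hc := continuous_cosExp_levy hμ
  have hq0 : cosExp μ 0 = 0 := by simp [cosExp]
  have ht' : 0 < 1 / t := by positivity
  set S := {ξ : ℝ | 0 < ξ ∧ 1 / t ≤ (charExponent a μ ξ).re} with hS
  -- The exponent vanishes at `0`, so allowing `ξ = 0` adds nothing. The set is thus closed and the
  -- infimum attained; the intermediate value theorem then excludes a strict inequality there.
  have hS' : S = {ξ : ℝ | 0 ≤ ξ} ∩ {ξ : ℝ | 1 / t ≤ cosExp μ ξ} := by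
    ext ξ
    simp only [hS, Set.mem_ofPred_eq, Set.mem_inter_iff, re_charExponent hμ]
    refine ⟨fun h => ⟨h.1.le, h.2⟩, fun h => ⟨h.1.lt_of_ne' ?_, h.2⟩⟩
    rintro rfl
    rw [hq0] at h
    linarith [h.2]
  have hclosed : IsClosed S := by
    rw [hS']
    exact (isClosed_le continuous_const continuous_id).inter (isClosed_le continuous_const hc)
  have hne : S.Nonempty := by
    obtain ⟨n, hn⟩ := ((tendsto_psiU_atTop hμ hinf hβ hA).eventually_ge_atTop
      (3 * β * (1 / t))).exists
    refine ⟨2 ^ n, by positivity, ?_⟩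
    rw [re_charExponent hμ]
    have := hn.trans (psiU_le_cosExp hμ hβ hA _)
    exact le_of_mul_le_mul_left this (by linarith)
  have hbdd : BddBelow S := ⟨0, fun ξ h => h.1.le⟩
  have hmem : rho (charExponent a μ) t ∈ S := hclosed.csInf_mem hne hbdd
  refine ⟨hmem.1, ?_⟩
  set ρ := rho (charExponent a μ) t with hρ
  have hge : 1 / t ≤ cosExp μ ρ := by
    have := hmem.2
    rwa [re_charExponent hμ] at this
  obtain ⟨ξ, hξ, hξt⟩ := intermediate_value_Icc hmem.1.le hc.continuousOn
    (show 1 / t ∈ Set.Icc (cosExp μ 0) (cosExp μ ρ) from ⟨by rw [hq0]; exact ht'.le, hge⟩)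
  have hξS : ξ ∈ S := by rw [hS']; exact ⟨hξ.1, hξt.ge⟩
  have : ρ ≤ ξ := csInf_le hbdd hξS
  rw [show ρ = ξ from le_antisymm this hξ.2, hξt]
  field_simp

/-- The jumps of size at most `1 / ρ`, with intensity `t`. -/
noncomputable def smallJumps (μ : Measure ℝ) (ρ t : ℝ) : Measure ℝ :=
  ENNReal.ofReal t • μ.restrict {u : ℝ | |ρ * u| ≤ 1}

/-- The jumps of size larger than `1 / ρ`, with intensity `t`. -/
noncomputable def bigJumps (μ : Measure ℝ) (ρ t : ℝ) : Measure ℝ :=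
  ENNReal.ofReal t • μ.restrict {u : ℝ | 1 < |ρ * u|}

variable {ρ t : ℝ}

theorem measurableSet_smallJumps (ρ : ℝ) : MeasurableSet {u : ℝ | |ρ * u| ≤ 1} :=
  measurableSet_le (by fun_prop) measurable_const

theorem measurableSet_bigJumps (ρ : ℝ) : MeasurableSet {u : ℝ | 1 < |ρ * u|} :=
  measurableSet_lt measurable_const (by fun_prop)

theorem cosExp_small_add_big (hμ : IsLevyMeasure μ) (ht : 0 ≤ t) (ξ : ℝ) :
    cosExp (smallJumps μ ρ t) ξ + cosExp (bigJumps μ ρ t) ξ = t * cosExp μ ξ := by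
  have h := integral_add_compl (measurableSet_smallJumps ρ) (integrable_one_sub_cos_levy hμ ξ)
  have hc : {u : ℝ | |ρ * u| ≤ 1}ᶜ = {u : ℝ | 1 < |ρ * u|} := by ext u; simp
  rw [hc] at h
  simp only [cosExp, smallJumps, bigJumps, integral_smul_measure, ENNReal.toReal_ofReal ht,
    smul_eq_mul]
  rw [← mul_add, h]

theorem bigJumps_real_univ_le (hμ : IsLevyMeasure μ) (ht : 0 ≤ t) :
    IsFiniteMeasure (bigJumps μ ρ t) ∧ (bigJumps μ ρ t).real Set.univ ≤ t * psiU μ ρ := by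
  have hi := integrable_min_sq_one hμ ρ
  have hsub : {u : ℝ | 1 < |ρ * u|} ⊆ {u | 1 ≤ ‖min ((ρ * u) ^ 2) 1‖} := fun u hu => by
    have hu' : 1 < |ρ * u| := hu
    change 1 ≤ ‖min ((ρ * u) ^ 2) 1‖
    rw [min_eq_right (by rw [← sq_abs]; exact one_le_pow₀ hu'.le), norm_one]
  have hfin : μ {u : ℝ | 1 < |ρ * u|} < ∞ :=
    (measure_mono hsub).trans_lt (hi.measure_norm_ge_lt_top one_pos)
  refine ⟨⟨?_⟩, ?_⟩
  · rw [bigJumps, Measure.smul_apply, Measure.restrict_apply_univ, smul_eq_mul]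
    exact ENNReal.mul_lt_top ENNReal.ofReal_lt_top hfin
  · rw [bigJumps, Measure.real, Measure.smul_apply, Measure.restrict_apply_univ, smul_eq_mul,
      ENNReal.toReal_mul, ENNReal.toReal_ofReal ht]
    refine mul_le_mul_of_nonneg_left ?_ ht
    change μ.real _ ≤ _
    rw [psiU, ← integral_indicator_one (measurableSet_bigJumps ρ)]
    refine integral_mono_of_nonneg (ae_of_all _ fun u => Set.indicator_nonneg (by simp) u) hi
      (ae_of_all _ fun u => ?_)
    by_cases hu : u ∈ {u : ℝ | 1 < |ρ * u|}
    · simp only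
      rw [Set.indicator_of_mem hu]
      have hu' : 1 < |ρ * u| := hu
      rw [min_eq_right (by rw [← sq_abs]; exact one_le_pow₀ hu'.le), Pi.one_apply]
    · simp only
      rw [Set.indicator_of_notMem hu]
      positivity

theorem cosExp_le_two_mul (Q : Measure ℝ) [IsFiniteMeasure Q] (ξ : ℝ) :
    cosExp Q ξ ≤ 2 * Q.real Set.univ := by
  have h : ∫ _ : ℝ, (2 : ℝ) ∂Q = 2 * Q.real Set.univ := by simp [mul_comm]
  rw [← h]
  exact integral_mono_of_nonneg (ae_of_all _ fun v => one_sub_cos_nonneg _) (integrable_const _)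
    (ae_of_all _ fun v => by simp only; linarith [Real.neg_one_le_cos (ξ * v)])

/-- The truncation set is symmetric, so the sine integral vanishes; the big jumps are symmetric and
equal their own symmetrization. -/
theorem charFun_bigJumps (hμ : IsLevyMeasure μ) {a : ℝ}
    (him : ∀ ξ, (charExponent a μ ξ).im = 0) (ht : 0 ≤ t) (ξ : ℝ) :
    charFun (bigJumps μ ρ t) ξ =
      (((bigJumps μ ρ t).real Set.univ - cosExp (bigJumps μ ρ t) ξ : ℝ) : ℂ) := by
  have hfin := (bigJumps_real_univ_le (ρ := ρ) hμ ht).1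
  rw [← charFun_symmetrize]
  have h2 : (bigJumps μ ρ t).map (fun u => -u) = bigJumps μ ρ t := by
    refine Measure.ext_of_charFun ?_
    ext ξ
    have h3 := charFun_map_mul (μ := bigJumps μ ρ t) (-1) ξ
    simp only [neg_mul, one_mul] at h3
    rw [h3, charFun_neg, Complex.conj_eq_iff_im, charFun_apply_real]
    have h4 : Integrable (fun x : ℝ => Complex.exp (ξ * x * Complex.I)) (bigJumps μ ρ t) :=
      Integrable.of_bound (by fun_prop) 1 (ae_of_all _ fun x => by
        rw [← Complex.ofReal_mul, Complex.norm_exp_ofReal_mul_I])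
    refine (integral_im (𝕜 := ℂ) h4).symm.trans ?_
    have h5 : ∀ x : ℝ, RCLike.im (Complex.exp (ξ * x * Complex.I)) = Real.sin (ξ * x) := fun x => by
      rw [← Complex.ofReal_mul]; exact Complex.exp_ofReal_mul_I_im _
    simp_rw [h5]
    rw [bigJumps, integral_smul_measure, ← integral_indicator (measurableSet_bigJumps ρ),
      integral_eq_zero_of_odd hμ him, smul_zero]
    intro u
    simp only [Set.indicator, Set.mem_ofPred_eq, mul_neg, abs_neg, Real.sin_neg]
    split_ifs <;> simp
  rw [symmetrize, h2, ← two_smul ℝ≥0 (bigJumps μ ρ t), smul_smul]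
  simp

theorem cosExp_map_mul (Q : Measure ℝ) (ρ η : ℝ) :
    cosExp (Q.map fun u => ρ * u) η = cosExp Q (ρ * η) := by
  rw [cosExp, cosExp, integral_map (by fun_prop) (by fun_prop)]
  congr 1 with u
  ring_nf

/-- The rescaled small jumps satisfy the hypotheses of the density estimates, with constants that
depend only on condition A. -/
theorem isSmallJump_map (hμ : IsLevyMeasure μ) {β : ℝ} (hβ : 1 < β)
    (hA : ∀ ξ, psiU μ ξ ≤ β * psiL μ ξ) (ht : 0 < t) (hρt : t * cosExp μ ρ = 1) :
    IsSmallJump ((smallJumps μ ρ t).map fun u => ρ * u) (3 * β) (decayConst β) := by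
  have hm : Measurable fun u : ℝ => ρ * u := by fun_prop
  have hU : t * psiU μ ρ ≤ 3 * β := by
    calc t * psiU μ ρ ≤ t * (3 * β * cosExp μ ρ) :=
        mul_le_mul_of_nonneg_left (psiU_le_cosExp hμ hβ hA ρ) ht.le
      _ = 3 * β * (t * cosExp μ ρ) := by ring
      _ = 3 * β := by rw [hρt, mul_one]
  have hU2 : 1 ≤ 2 * (t * psiU μ ρ) := by
    have := mul_le_mul_of_nonneg_left (cosExp_le_psiU hμ ρ) ht.le
    linarith
  have hae : ∀ᵐ u ∂(smallJumps μ ρ t), |ρ * u| ≤ 1 :=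
    Measure.ae_smul_measure (ae_restrict_mem (measurableSet_smallJumps ρ)) _
  have hmin : ∀ u : ℝ, |ρ * u| ≤ 1 → min ((ρ * u) ^ 2) 1 = (ρ * u) ^ 2 := fun u hu =>
    min_eq_left ((sq_le_one_iff_abs_le_one _).2 hu)
  have hi : Integrable (fun u : ℝ => min ((ρ * u) ^ 2) 1) (smallJumps μ ρ t) :=
    ((integrable_min_sq_one hμ ρ).restrict).smul_measure ENNReal.ofReal_ne_top
  have hi2 : Integrable (fun u : ℝ => (ρ * u) ^ 2) (smallJumps μ ρ t) :=
    hi.congr (hae.mono hmin)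
  refine ⟨?_, ?_, ?_, ?_⟩
  · rw [ae_map_iff hm.aemeasurable (measurableSet_le (by fun_prop) measurable_const)]
    exact hae
  · rw [integrable_map_measure (by fun_prop) hm.aemeasurable]
    exact hi2
  · rw [integral_map hm.aemeasurable (by fun_prop), ← integral_congr_ae (hae.mono hmin), smallJumps,
      integral_smul_measure, ENNReal.toReal_ofReal ht.le, smul_eq_mul]
    refine le_trans (mul_le_mul_of_nonneg_left ?_ ht.le) hU
    exact setIntegral_le_integral (integrable_min_sq_one hμ ρ) (ae_of_all _ fun u => by positivity)
  · intro k η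
    have hfin := (bigJumps_real_univ_le (ρ := ρ) hμ ht.le).1
    -- Removing the big jumps lowers the full exponent by at most twice their mass, so its growth
    -- passes to the small jumps.
    have hbig : cosExp (bigJumps μ ρ t) (ρ * η) ≤ 6 * β := by
      have h1 := cosExp_le_two_mul (bigJumps μ ρ t) (ρ * η)
      have h2 := (bigJumps_real_univ_le (ρ := ρ) hμ ht.le).2
      linarith
    rw [cosExp_map_mul]
    have hsum := cosExp_small_add_big (ρ := ρ) hμ ht.le (ρ * η)
    rcases lt_or_ge |η| 1 with h1 | h1
    · refine pow_mul_exp_neg_le (n := 0) hβ (abs_nonneg η) (by norm_num; linarith) ?_ k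
      have h0 := cosExp_nonneg (smallJumps μ ρ t) (ρ * η)
      have h3 : (1 + 3 / (4 * β)) ^ 0 / (6 * β) ≤ 1 := by
        rw [pow_zero, div_le_one (by positivity)]; linarith
      linarith
    · obtain ⟨n, hn1, hn2⟩ := exists_two_pow_le h1
      refine pow_mul_exp_neg_le (n := n) hβ (abs_nonneg η) hn2.le ?_ k
      have h2 : (1 + 3 / (4 * β)) ^ n * psiU μ ρ ≤ psiU μ (ρ * η) := by
        refine (psiU_two_pow hμ hβ hA ρ n).trans (psiU_mono hμ ?_)
        rw [abs_mul, abs_mul, mul_comm, abs_of_pos (by positivity : (0 : ℝ) < 2 ^ n)]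
        gcongr
      have h3 := psiU_le_cosExp hμ hβ hA (ρ * η)
      have h4 : (1 + 3 / (4 * β)) ^ n / (6 * β) ≤ t * cosExp μ (ρ * η) := by
        rw [div_le_iff₀ (by positivity)]
        have hκ : 0 ≤ (1 + 3 / (4 * β)) ^ n := by positivity
        calc (1 + 3 / (4 * β)) ^ n ≤ (1 + 3 / (4 * β)) ^ n * (2 * (t * psiU μ ρ)) :=
              le_mul_of_one_le_right hκ hU2
          _ = 2 * t * ((1 + 3 / (4 * β)) ^ n * psiU μ ρ) := by ring
          _ ≤ 2 * t * (3 * β * cosExp μ (ρ * η)) :=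
              mul_le_mul_of_nonneg_left (h2.trans h3) (by positivity)
          _ = _ := by ring
      linarith

end Decomposition

/-! ### The transition density -/

section TransitionDensity

variable {μ : Measure ℝ} {ρ t β : ℝ}

/-- The transition density, as the convolution of the density of the small jumps with the compound
Poisson law of the big jumps. -/
noncomputable def transitionDensity (μ : Measure ℝ) (ρ t x : ℝ) : ℝ :=
  Real.exp (-(bigJumps μ ρ t).real Set.univ) * ρ *
    scaledConv (jumpDensity ((smallJumps μ ρ t).map fun u => ρ * u)) ρ
      (convExp (bigJumps μ ρ t)) x

theorem abs_scaledConv_le {G h : ℝ → ℝ} {E : Measure ℝ} [IsFiniteMeasure E] {M : ℝ}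
    (hm : Measurable h) (hM : ∀ x, |h x| ≤ M) (hGh : ∀ x, |G x| ≤ h x) (ρ x : ℝ) :
    |scaledConv G ρ E x| ≤ scaledConv h ρ E x :=
  norm_integral_le_of_norm_le (f := fun y => G ((x - y) * ρ)) (integrable_scaledConv hm hM ρ x)
    (ae_of_all _ fun _ => hGh _)

theorem transitionDensity_nonneg (hρ : 0 < ρ) {K : ℝ} {D : ℕ → ℝ}
    (hs : IsSmallJump ((smallJumps μ ρ t).map fun u => ρ * u) K D) (x : ℝ) :
    0 ≤ transitionDensity μ ρ t x :=
  mul_nonneg (mul_nonneg (Real.exp_nonneg _) hρ.le)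
    (integral_nonneg fun _ => hs.jumpDensity_nonneg _)

theorem contDiff_transitionDensity [IsFiniteMeasure (bigJumps μ ρ t)] {K : ℝ} {D : ℕ → ℝ}
    (hs : IsSmallJump ((smallJumps μ ρ t).map fun u => ρ * u) K D) :
    ContDiff ℝ (⊤ : ℕ∞) (transitionDensity μ ρ t) :=
  contDiff_const.mul (contDiff_scaledConv hs.contDiff_jumpDensity hs.abs_iteratedDeriv_le_const ρ)

/-- The exponents of the two parts add up to `t ψ`: rescaling by `ρ` cancels, and the normalizing
factor cancels the mass of the big jumps. -/
theorem charFun_transitionDensity (hμ : IsLevyMeasure μ) {a : ℝ}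
    (him : ∀ ξ, (charExponent a μ ξ).im = 0) (ht : 0 < t) (hρ : 0 < ρ) {K : ℝ} {D : ℕ → ℝ}
    (hs : IsSmallJump ((smallJumps μ ρ t).map fun u => ρ * u) K D) (ξ : ℝ) :
    charFun (volume.withDensity fun x => ENNReal.ofReal (transitionDensity μ ρ t x)) ξ =
      Complex.exp (-(t : ℂ) * charExponent a μ ξ) := by
  have hfin := (bigJumps_real_univ_le (ρ := ρ) hμ ht.le).1
  rw [charFun_withDensity_ofReal (contDiff_transitionDensity hs).continuous.measurable
    (transitionDensity_nonneg hρ hs)]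
  have e : ∀ x : ℝ, Complex.exp (ξ * x * Complex.I) * (transitionDensity μ ρ t x : ℂ) =
      ((Real.exp (-(bigJumps μ ρ t).real Set.univ) : ℝ) : ℂ) *
      (Complex.exp (ξ * x * Complex.I) *
        ((ρ * scaledConv (jumpDensity ((smallJumps μ ρ t).map fun u => ρ * u)) ρ
          (convExp (bigJumps μ ρ t)) x : ℝ) : ℂ)) := fun x => by
    rw [transitionDensity]; push_cast; ring
  simp_rw [e]
  rw [integral_const_mul, integral_exp_mul_scaledConv hs.integrable_jumpDensity hρ,
    hs.integral_exp_mul_jumpDensity, charFun_convExp, charFun_bigJumps hμ him ht.le,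
    cosExp_map_mul, mul_div_cancel₀ _ hρ.ne', Complex.ofReal_exp, ← Complex.exp_add,
    ← Complex.exp_add]
  congr 1
  have h1 : charExponent a μ ξ = ((cosExp μ ξ : ℝ) : ℂ) := by
    apply Complex.ext
    · rw [re_charExponent hμ, Complex.ofReal_re]
    · rw [him, Complex.ofReal_im]
  have h2 := cosExp_small_add_big (ρ := ρ) hμ ht.le ξ
  rw [h1, neg_mul, ← Complex.ofReal_mul, ← h2]
  push_cast
  ring

theorem integrable_transitionDensity [IsFiniteMeasure (bigJumps μ ρ t)] (hρ : 0 < ρ) {K : ℝ}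
    {D : ℕ → ℝ} (hs : IsSmallJump ((smallJumps μ ρ t).map fun u => ρ * u) K D) :
    Integrable (transitionDensity μ ρ t) :=
  (integrable_scaledConv_volume hs.integrable_jumpDensity hρ.ne').const_mul _

theorem abs_iteratedDeriv_transitionDensity_le [IsFiniteMeasure (bigJumps μ ρ t)] (hρ : 0 < ρ)
    {K : ℝ} {D : ℕ → ℝ} (hs : IsSmallJump ((smallJumps μ ρ t).map fun u => ρ * u) K D) (k : ℕ)
    (x : ℝ) :
    |iteratedDeriv k (transitionDensity μ ρ t) x| ≤
      ρ ^ (k + 1) * scaledConv (fUpperSym (jumpConst K D k) (1 / 8)) ρ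
        (convExp (bigJumps μ ρ t)) x := by
  have hb := (hs.jumpConst_pos k).le
  have h := abs_scaledConv_le (E := convExp (bigJumps μ ρ t)) (M := jumpConst K D k)
    (measurable_fUpperSym (jumpConst K D k) (1 / 8)) (fun x => by
      rw [abs_of_nonneg (fUpperSym_nonneg hb x)]; exact fUpperSym_le hb (by norm_num) x)
    (hs.abs_iteratedDeriv_le k) ρ x
  have e : iteratedDeriv k (transitionDensity μ ρ t) x =
      Real.exp (-(bigJumps μ ρ t).real Set.univ) * (ρ ^ (k + 1) *
        scaledConv (iteratedDeriv k (jumpDensity ((smallJumps μ ρ t).map fun u => ρ * u))) ρ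
          (convExp (bigJumps μ ρ t)) x) := by
    have h1 := iteratedDeriv_const_mul_field (n := k) (x := x)
      (Real.exp (-(bigJumps μ ρ t).real Set.univ) * ρ)
      (scaledConv (jumpDensity ((smallJumps μ ρ t).map fun u => ρ * u)) ρ
          (convExp (bigJumps μ ρ t)))
    rw [iteratedDeriv_scaledConv hs.contDiff_jumpDensity hs.abs_iteratedDeriv_le_const] at h1
    refine h1.trans ?_
    ring
  rw [e, abs_mul, abs_mul, abs_of_pos (Real.exp_pos _), abs_of_pos (pow_pos hρ _)]
  -- The Poisson normalization is at most `1` and is dropped; only the lower bound needs to control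
  -- it, through a bound on the mass.
  refine (mul_le_of_le_one_left (by positivity) (Real.exp_le_one_iff.2 ?_)).trans
    (mul_le_mul_of_nonneg_left h (by positivity))
  rw [neg_nonpos]
  exact measureReal_nonneg

theorem le_transitionDensity [IsFiniteMeasure (bigJumps μ ρ t)] (hρ : 0 < ρ)
    {K L c b₄ : ℝ} {D : ℕ → ℝ} (hs : IsSmallJump ((smallJumps μ ρ t).map fun u => ρ * u) K D)
    (hL : (bigJumps μ ρ t).real Set.univ ≤ L) (hc : 0 ≤ c)
    (hlow : ∀ x, fLower c b₄ x ≤ jumpDensity ((smallJumps μ ρ t).map fun u => ρ * u) x) (x : ℝ) :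
    ρ * scaledConv (fLower (Real.exp (-L) * c) b₄) ρ (convExp (bigJumps μ ρ t)) x ≤
      transitionDensity μ ρ t x := by
  rw [transitionDensity, mul_comm _ ρ, mul_assoc]
  refine mul_le_mul_of_nonneg_left ?_ hρ.le
  rw [scaledConv, scaledConv, ← integral_const_mul]
  have hM : ∀ x, |jumpDensity ((smallJumps μ ρ t).map fun u => ρ * u) x| ≤ jumpConst K D 0 :=
    fun x => by simpa using hs.abs_iteratedDeriv_le_const 0 x
  refine integral_mono
    (integrable_scaledConv (measurable_fLower _ _) (abs_fLower_le (by positivity) _) ρ x)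
    ((integrable_scaledConv hs.contDiff_jumpDensity.continuous.measurable hM ρ x).const_mul _)
    fun y => ?_
  have e : ∀ z, fLower (Real.exp (-L) * c) b₄ z = Real.exp (-L) * fLower c b₄ z := fun z => by
    simp only [fLower, mul_assoc]
  simp only [e]
  have h1 : Real.exp (-L) ≤ Real.exp (-(bigJumps μ ρ t).real Set.univ) :=
    Real.exp_le_exp.2 (neg_le_neg hL)
  exact mul_le_mul h1 (hlow _) (by unfold fLower; positivity) (Real.exp_nonneg _)

end TransitionDensity

end LevyKernel

theorem theorem4 {Ω : Type*} [MeasurableSpace Ω] (P : Measure Ω) [IsProbabilityMeasure P]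
    (Z : ℝ≥0 → Ω → ℝ) (hZ : LevyKernel.IsLevyProcess Z P)
    (a : ℝ) (μ : Measure ℝ) (hμ : LevyKernel.IsLevyMeasure μ) (hμ_inf : μ Set.univ = ∞)
    (ψ : ℝ → ℂ) (hψ : ψ = LevyKernel.charExponent a μ)
    (hZψ : LevyKernel.HasCharExponent Z P ψ)
    (hsymm : LevyKernel.IsSymmetricProcess Z P)
    (hA : LevyKernel.ConditionA μ) :
    ∃ p : ℝ → ℝ → ℝ, LevyKernel.IsSmoothTransitionDensity Z P p ∧
      (∀ t₀ : ℝ, 0 < t₀ → ∃ b₁ b₂ b₃ b₄ : ℝ, 0 < b₁ ∧ 0 < b₂ ∧ 0 < b₃ ∧ 0 < b₄ ∧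
        LevyKernel.UpperCompoundKernelEstimate (fun t x => p t x)
          (Set.Ioc 0 t₀ ×ˢ Set.univ)
          (LevyKernel.rho ψ) (LevyKernel.fUpperSym b₁ b₂) (LevyKernel.rho ψ)
          (LevyKernel.Lam ψ μ) ∧
        LevyKernel.LowerCompoundKernelEstimate (fun t x => p t x)
          (Set.Ioc 0 t₀ ×ˢ Set.univ)
          (LevyKernel.rho ψ) (LevyKernel.fLower b₃ b₄) (LevyKernel.rho ψ)
          (LevyKernel.Lam ψ μ)) ∧
      (∀ k : ℕ, 1 ≤ k → ∀ t₀ : ℝ, 0 < t₀ → ∃ b₁ b₂ : ℝ, 0 < b₁ ∧ 0 < b₂ ∧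
        LevyKernel.UpperCompoundKernelEstimate (fun t x => |iteratedDeriv k (p t) x|)
          (Set.Ioc 0 t₀ ×ˢ Set.univ)
          (fun t => LevyKernel.rho ψ t ^ (k + 1)) (LevyKernel.fUpperSym b₁ b₂)
          (LevyKernel.rho ψ) (LevyKernel.Lam ψ μ)) := by
  open LevyKernel in
  obtain ⟨β, hβ, hA⟩ := hA
  have him : ∀ ξ, (charExponent a μ ξ).im = 0 := fun ξ => by
    rw [← hψ]; exact im_eq_zero_of_symmetric hZ.measurable hZψ hsymm ξ
  have hρ : ∀ t, 0 < t → 0 < rho ψ t ∧ t * cosExp μ (rho ψ t) = 1 := fun t ht => by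
    rw [hψ]; exact rho_pos_and_cosExp_rho hμ hμ_inf hβ hA a ht
  have hs : ∀ t, 0 < t → IsSmallJump ((smallJumps μ (rho ψ t) t).map fun u => rho ψ t * u)
      (3 * β) (decayConst β) := fun t ht => isSmallJump_map hμ hβ hA ht (hρ t ht).2
  have hfin : ∀ t, 0 < t → IsFiniteMeasure (bigJumps μ (rho ψ t) t) := fun t ht =>
    (bigJumps_real_univ_le hμ ht.le).1
  have hΛ : ∀ t, 0 < t → (bigJumps μ (rho ψ t) t).real Set.univ ≤ 3 * β := fun t ht => by
    have h1 := (bigJumps_real_univ_le (ρ := rho ψ t) hμ ht.le).2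
    have h2 := mul_le_mul_of_nonneg_left (psiU_le_cosExp hμ hβ hA (rho ψ t)) ht.le
    have h3 : t * (3 * β * cosExp μ (rho ψ t)) = 3 * β := by
      rw [mul_left_comm, (hρ t ht).2, mul_one]
    linarith
  -- The constants depend on `β` and `k` only, so any time may be used here, and the final constants
  -- do not depend on `t₀`.
  have hb : ∀ k, 0 < jumpConst (3 * β) (decayConst β) k := fun k =>
    (hs 1 one_pos).jumpConst_pos k
  have hupper : ∀ k t x, 0 < t →
      CompoundKernelConverges (fun t => rho ψ t ^ (k + 1))
        (fUpperSym (jumpConst (3 * β) (decayConst β) k) (1 / 8)) (rho ψ) (Lam ψ μ) t x ∧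
      |iteratedDeriv k (transitionDensity μ (rho ψ t) t) x| ≤
        ∑' m, compoundTerm (fun t => rho ψ t ^ (k + 1))
          (fUpperSym (jumpConst (3 * β) (decayConst β) k) (1 / 8)) (rho ψ) (Lam ψ μ) t x m := by
    intro k t x ht
    -- `Lam ψ μ t` unfolds to `bigJumps μ (rho ψ t) t`, so the earlier estimates apply verbatim.
    have hf : IsFiniteMeasure (Lam ψ μ t) := hfin t ht
    have hf' := hfin t ht
    have hM : ∀ x, |fUpperSym (jumpConst (3 * β) (decayConst β) k) (1 / 8) x| ≤
        jumpConst (3 * β) (decayConst β) k := fun x => by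
      rw [abs_of_nonneg (fUpperSym_nonneg (hb k).le x)]
      exact fUpperSym_le (hb k).le (by norm_num) x
    refine ⟨compoundKernelConverges (measurable_fUpperSym _ _) hM x, ?_⟩
    rw [(hasSum_compoundTerm (measurable_fUpperSym _ _) hM x).tsum_eq]
    exact abs_iteratedDeriv_transitionDensity_le (hρ t ht).1 (hs t ht) k x
  refine ⟨fun t => transitionDensity μ (rho ψ t) t, ?_, ?_, ?_⟩
  · intro t ht
    have ht' : (0 : ℝ) < t := ht
    have hf := hfin t ht'
    have hnn := transitionDensity_nonneg (hρ t ht').1 (hs t ht')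
    refine ⟨contDiff_transitionDensity (hs t ht'), hnn, ?_⟩
    have hf1 : IsFiniteMeasure (volume.withDensity fun x : ℝ =>
        ENNReal.ofReal (transitionDensity μ (rho ψ t) t x)) :=
      isFiniteMeasure_withDensity_ofReal (integrable_transitionDensity (hρ t ht').1 (hs t ht')).2
    refine Measure.ext_of_charFun ?_
    ext ξ
    rw [hZψ, charFun_transitionDensity hμ him ht' (hρ t ht').1 (hs t ht'), hψ]
  · intro t₀ _
    have hβ0 : 0 < β := by linarith
    have hpi := Real.pi_pos
    have hb1 := hb 1
    refine ⟨jumpConst (3 * β) (decayConst β) 0, 1 / 8,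
      Real.exp (-(3 * β)) * (Real.sqrt (Real.pi / (2 * Real.pi ^ 2 * (3 * β + 1))) / 2),
      Real.sqrt (Real.pi / (2 * Real.pi ^ 2 * (3 * β + 1))) /
        (2 * jumpConst (3 * β) (decayConst β) 1),
      hb 0, by norm_num, by positivity, by positivity, ?_, ?_⟩
    · rintro t x ⟨⟨ht, _⟩, _⟩
      have h := hupper 0 t x ht
      simp only [zero_add, pow_one, iteratedDeriv_zero] at h
      exact ⟨h.1, (le_abs_self _).trans h.2⟩
    · rintro t x ⟨⟨ht, _⟩, _⟩
      have hf : IsFiniteMeasure (Lam ψ μ t) := hfin t ht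
      have hf' := hfin t ht
      have hM := abs_fLower_le (b₃ := Real.exp (-(3 * β)) *
        (Real.sqrt (Real.pi / (2 * Real.pi ^ 2 * (3 * β + 1))) / 2)) (by positivity)
        (Real.sqrt (Real.pi / (2 * Real.pi ^ 2 * (3 * β + 1))) /
          (2 * jumpConst (3 * β) (decayConst β) 1))
      refine ⟨compoundKernelConverges (measurable_fLower _ _) hM x, ?_⟩
      rw [(hasSum_compoundTerm (measurable_fLower _ _) hM x).tsum_eq]
      exact le_transitionDensity (hρ t ht).1 (hs t ht) (hΛ t ht) (by positivity)
        (hs t ht).fLower_le x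
  · intro k _ t₀ _
    refine ⟨jumpConst (3 * β) (decayConst β) k, 1 / 8, hb k, by norm_num, ?_⟩
    rintro t x ⟨⟨ht, _⟩, _⟩
    exact hupper k t x ht
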